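/- **Notation.** Let $\sigma>1$, $\tau,h>0$, and let $U\subseteq\mathbf R^d$ be open. For $\varphi\in C_c^\infty(U)$ put $$\|\varphi\|_{\tau,\sigma,h}=\sup_{\alpha\in\mathbf N^d}\sup_{x}\frac{|\partial^\alpha\varphi(x)|}{h^{|\alpha|^\sigma}|\alpha|^{\tau|\alpha|^\sigma}}\qquad(0^0=1),$$ and for compact $K\subset U$ let $\mathcal D^K_{\tau,\sigma,h}$ be the normed space of all $\varphi\in C_c^\infty(U)$ with $\operatorname{supp}\varphi\subseteq K$ and $\|\varphi\|_{\tau,\sigma,h}<\infty$. With limits taken in the category of locally convex spaces, put $$\mathcal D_{(\tau,\sigma)}(U)=\varinjlim_{K\subset\subset U}\varprojlim_{h\to0}\mathcal D^K_{\tau,\sigma,h},\qquad \mathcal D_{\{\tau,\sigma\}}(U)=\varinjlim_{K\subset\subset U}\varinjlim_{h\to\infty}\mathcal D^K_{\tau,\sigma,h},$$ $$\mathcal D^{(\sigma)}(U)=\varprojlim_{\tau\to0}\mathcal D_{(\tau,\sigma)}(U),\qquad \mathcal D^{\{\sigma\}}(U)=\varinjlim_{\tau\to\infty}\mathcal D_{\{\tau,\sigma\}}(U).$$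 Let $\mathcal D'_{(\tau,\sigma)}(U)$, $\mathcal D'_{\{\tau,\sigma\}}(U)$, $\mathcal D'^{(\sigma)}(U)$, $\mathcal D'^{\{\sigma\}}(U)$ be their duals, with the strong topology (uniform convergence on bounded sets). For $k>0$ let $$T_{\tau,\sigma,h}(k)=\sup_{p\in\mathbf N}\ln\frac{h^{p^\sigma}k^p}{p^{\tau p^\sigma}}.$$ **Theorem.** Let $\sigma>1$, let $U\subseteq\mathbf R^d$ be open, let $\Gamma\subseteq\mathbf R^d$ be a connected open cone (that is, $ty\in\Gamma$ whenever $y\in\Gamma$ and $t>0$), and let $\gamma>0$. Let $F$ be analytic on $$Z=\{z\in\mathbf C^d : \operatorname{Re}z\in U,\ \operatorname{Im}z\in\Gamma,\ |\operatorname{Im}z|<\gamma\}.$$ 1. Suppose that $$|F(x+iy)|\le A\,|y|^{-H\left(\frac{\ln(1/|y|)}{\ln\ln(1/|y|)}\right)^{\frac1{\sigma-1}}}\qquad\text{for all }x+iy\in Z\text{ with }0<|y|<1/e,$$ for some $A,H>0$ (resp. for every $H>0$ with some $A=A(H)>0$). Then, for $y\in\Gamma$, $|y|<\gamma$, the functions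 $x\mapsto F(x+iy)$ define elements of $\mathcal D'^{(\sigma)}(U)$ (resp. $\mathcal D'^{\{\sigma\}}(U)$), and they converge in this space, to a limit denoted by $F(x+i0)$, as $y\to0$, $y\in\Gamma$. 2. More precisely, let $\tau>0$ and suppose that $$|F(x+iy)|\le A\exp\{T_{(2^\sigma-1)\tau,\sigma,H}(1/|y|)\}\qquad\text{for all }x+iy\in Z\text{ with }y\neq0,$$ for some $A,H>0$ (resp. for every $H>0$ with some $A=A(H)>0$). Then the functions $x\mapsto F(x+iy)$, $y\in\Gamma$, $|y|<\gamma$, define elements of $\mathcal D'_{(\tau/2^{\sigma-1},\sigma)}(U)$ (resp. $\mathcal D'_{\{\tau/2^{\sigma-1},\sigma\}}(U)$), and they converge in this space as $y\to0$, $y\in\Gamma$. -/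

import Mathlib

open Filter Topology MeasureTheory TopologicalSpace
open scoped ENNReal NNReal Distributions

noncomputable section

namespace ExtGevrey

/-- The weight `h ^ (n ^ σ) * n ^ (τ * n ^ σ)` (with `0 ^ 0 = 1`, so the weight is `1` at
`n = 0`). -/
def weight (τ σ h : ℝ) (n : ℕ) : ℝ :=
  h ^ ((n : ℝ) ^ σ) * (n : ℝ) ^ (τ * (n : ℝ) ^ σ)

/-- The associated function
`T_{τ,σ,h}(k) = sup_p log (h ^ (p ^ σ) * k ^ p / p ^ (τ * p ^ σ))`, for `k > 0`.
For `τ, h, k > 0` and `σ > 1` the supremum is finite. -/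
def assocFun (τ σ h k : ℝ) : ℝ :=
  ⨆ p : ℕ, Real.log (h ^ ((p : ℝ) ^ σ) * k ^ p / (p : ℝ) ^ (τ * (p : ℝ) ^ σ))

section TestSpaces

variable {d : ℕ} {U : Opens (EuclideanSpace ℝ (Fin d))}

/-- The iterated partial derivative `∂_{s 0} ⋯ ∂_{s (n-1)} φ (x)`. For smooth `φ` the order of the
indices is irrelevant, and as `s` runs over all sequences of length `n` these are exactly the
derivatives `∂^α φ (x)` with `|α| = n`. -/
def partialDeriv {n : ℕ} (s : Fin n → Fin d) (φ : EuclideanSpace ℝ (Fin d) → ℂ)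
    (x : EuclideanSpace ℝ (Fin d)) : ℂ :=
  iteratedFDeriv ℝ n φ x (fun i => EuclideanSpace.single (s i) (1 : ℝ))

/-- The norm `sup_α sup_x |∂^α φ (x)| / (h ^ (|α| ^ σ) * |α| ^ (τ * |α| ^ σ))`, as an extended
nonnegative number. For `φ` supported in a compact set `K` the supremum over `x ∈ K` and the one
over all `x` agree. -/
def ultraNorm (τ σ h : ℝ) (φ : 𝓓(U, ℂ)) : ℝ≥0∞ :=
  ⨆ (n : ℕ) (s : Fin n → Fin d) (x : EuclideanSpace ℝ (Fin d)),
    ENNReal.ofReal (‖partialDeriv s φ x‖ / weight τ σ h n)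

lemma weight_nonneg (τ σ : ℝ) {h : ℝ} (hh : 0 ≤ h) (n : ℕ) : 0 ≤ weight τ σ h n := by
  unfold weight; positivity

lemma le_ultraNorm (τ σ h : ℝ) (φ : 𝓓(U, ℂ)) {n : ℕ} (s : Fin n → Fin d)
    (x : EuclideanSpace ℝ (Fin d)) :
    ENNReal.ofReal (‖partialDeriv s φ x‖ / weight τ σ h n) ≤ ultraNorm τ σ h φ := by
  unfold ultraNorm
  exact le_iSup_of_le n (le_iSup_of_le s (le_iSup_of_le x le_rfl))

lemma ultraNorm_zero (τ σ h : ℝ) : ultraNorm τ σ h (0 : 𝓓(U, ℂ)) = 0 := by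
  have : ⇑(0 : 𝓓(U, ℂ)) = fun _ => 0 := rfl
  simp [ultraNorm, partialDeriv, this]

lemma ultraNorm_add_le (τ σ : ℝ) {h : ℝ} (hh : 0 ≤ h) (φ ψ : 𝓓(U, ℂ)) :
    ultraNorm τ σ h (φ + ψ) ≤ ultraNorm τ σ h φ + ultraNorm τ σ h ψ := by
  refine iSup_le fun n => iSup_le fun s => iSup_le fun x => ?_
  have e : partialDeriv s (⇑(φ + ψ)) x = partialDeriv s φ x + partialDeriv s ψ x := by
    have h1 : ContDiffAt ℝ n φ x := (φ.contDiff.of_le (by exact_mod_cast le_top)).contDiffAt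
    have h2 : ContDiffAt ℝ n ψ x := (ψ.contDiff.of_le (by exact_mod_cast le_top)).contDiffAt
    have h3 : ⇑(φ + ψ) = ⇑φ + ⇑ψ := rfl
    unfold partialDeriv
    rw [h3, iteratedFDeriv_add_apply h1 h2]
    rfl
  have hw := weight_nonneg τ σ hh n
  calc ENNReal.ofReal (‖partialDeriv s (⇑(φ + ψ)) x‖ / weight τ σ h n)
      ≤ ENNReal.ofReal (‖partialDeriv s φ x‖ / weight τ σ h n
          + ‖partialDeriv s ψ x‖ / weight τ σ h n) := by
        apply ENNReal.ofReal_le_ofReal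
        rw [e, ← add_div]
        exact div_le_div_of_nonneg_right (norm_add_le _ _) hw
    _ ≤ ENNReal.ofReal (‖partialDeriv s φ x‖ / weight τ σ h n)
          + ENNReal.ofReal (‖partialDeriv s ψ x‖ / weight τ σ h n) := ENNReal.ofReal_add_le
    _ ≤ _ := add_le_add (le_ultraNorm τ σ h φ s x) (le_ultraNorm τ σ h ψ s x)

lemma ultraNorm_smul_le (τ σ h : ℝ) (c : ℂ) (φ : 𝓓(U, ℂ)) :
    ultraNorm τ σ h (c • φ) ≤ ENNReal.ofReal ‖c‖ * ultraNorm τ σ h φ := by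
  refine iSup_le fun n => iSup_le fun s => iSup_le fun x => ?_
  have e : partialDeriv s (⇑(c • φ)) x = c * partialDeriv s φ x := by
    have h1 : ContDiffAt ℝ n φ x := (φ.contDiff.of_le (by exact_mod_cast le_top)).contDiffAt
    have h3 : ⇑(c • φ) = c • ⇑φ := rfl
    unfold partialDeriv
    rw [h3, iteratedFDeriv_const_smul_apply h1]
    rfl
  rw [e, norm_mul, mul_div_assoc, ENNReal.ofReal_mul (norm_nonneg c)]
  exact mul_le_mul_right (le_ultraNorm τ σ h φ s x) _

lemma ultraNorm_mono {τ₁ τ₂ σ h₁ h₂ : ℝ} (hτ₁ : 0 < τ₁) (hτ : τ₁ ≤ τ₂) (hh₁ : 0 < h₁)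
    (hh : h₁ ≤ h₂) (φ : 𝓓(U, ℂ)) : ultraNorm τ₂ σ h₂ φ ≤ ultraNorm τ₁ σ h₁ φ := by
  refine iSup_mono fun n => iSup_mono fun s => iSup_mono fun x => ENNReal.ofReal_le_ofReal ?_
  have hh₂ := hh₁.trans_le hh
  by_cases hz : n = 0 ∧ σ = 0
  · obtain ⟨rfl, rfl⟩ := hz
    simp [weight, hτ₁.ne', (hτ₁.trans_le hτ).ne']
  have hpos : 0 < weight τ₁ σ h₁ n := by
    rcases Nat.eq_zero_or_pos n with rfl | hn
    · have : σ ≠ 0 := fun h => hz ⟨rfl, h⟩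
      simp [weight, Real.zero_rpow this]
    · have : (0 : ℝ) < n := by exact_mod_cast hn
      unfold weight; positivity
  have hle : weight τ₁ σ h₁ n ≤ weight τ₂ σ h₂ n := by
    rcases Nat.eq_zero_or_pos n with rfl | hn
    · have : σ ≠ 0 := fun h => hz ⟨rfl, h⟩
      simp [weight, Real.zero_rpow this]
    · have h1 : (1 : ℝ) ≤ n := by exact_mod_cast hn
      unfold weight
      gcongr
  exact div_le_div_of_nonneg_left (norm_nonneg _) hpos hle

/-- The locally convex topology generated by a set `P` of seminorms. -/
@[reducible]
def seminormTopology {V : Type*} [AddCommGroup V] [Module ℂ V] (P : Set (Seminorm ℂ V)) :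
    TopologicalSpace V :=
  ⨅ p ∈ P, p.toSeminormedAddCommGroup.toUniformSpace.toTopologicalSpace

/-! ### The Beurling space `D_{(τ,σ)}(U) = ind lim_K proj lim_{h → 0} D^K_{τ,σ,h}` -/

/-- Smooth functions with compact support in `U` all of whose norms, for every `h > 0`, are
finite. -/
def beurlingSubmodule (U : Opens (EuclideanSpace ℝ (Fin d))) (τ σ : ℝ) :
    Submodule ℂ 𝓓(U, ℂ) where
  carrier := {φ | ∀ h : ℝ, 0 < h → ultraNorm τ σ h φ < ∞}
  add_mem' hφ hψ h hh := (ultraNorm_add_le τ σ hh.le _ _).trans_lt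
    (ENNReal.add_lt_top.2 ⟨hφ h hh, hψ h hh⟩)
  zero_mem' h _ := by simp [ultraNorm_zero]
  smul_mem' c _ hφ h hh := (ultraNorm_smul_le τ σ h c _).trans_lt
    (ENNReal.mul_lt_top ENNReal.ofReal_lt_top (hφ h hh))

/-- `D_{(τ,σ)}(U)`. -/
def BeurlingSpace (U : Opens (EuclideanSpace ℝ (Fin d))) (τ σ : ℝ) : Type :=
  beurlingSubmodule U τ σ

instance (τ σ : ℝ) : AddCommGroup (BeurlingSpace U τ σ) :=
  inferInstanceAs (AddCommGroup (beurlingSubmodule U τ σ))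

instance (τ σ : ℝ) : Module ℂ (BeurlingSpace U τ σ) :=
  inferInstanceAs (Module ℂ (beurlingSubmodule U τ σ))

/-- The inclusion `D_{(τ,σ)}(U) → C_c^∞(U)`. -/
def BeurlingSpace.incl (U : Opens (EuclideanSpace ℝ (Fin d))) (τ σ : ℝ) :
    BeurlingSpace U τ σ →ₗ[ℂ] 𝓓(U, ℂ) :=
  (beurlingSubmodule U τ σ).subtype

/-- The locally convex inductive limit topology over compact `K ⊆ U`: it is generated by all
seminorms whose restriction to each `D^K_{(τ,σ)} = proj lim_{h → 0} D^K_{τ,σ,h}` is continuous,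
that is, dominated by one of the (directed) norms that define `D^K_{(τ,σ)}`. -/
instance (τ σ : ℝ) : TopologicalSpace (BeurlingSpace U τ σ) :=
  seminormTopology {p | ∀ K : Compacts (EuclideanSpace ℝ (Fin d)),
    (K : Set (EuclideanSpace ℝ (Fin d))) ⊆ U →
    ∃ h : ℝ, 0 < h ∧ ∃ C : ℝ, ∀ φ : BeurlingSpace U τ σ,
      tsupport (BeurlingSpace.incl U τ σ φ) ⊆ K →
      p φ ≤ C * (ultraNorm τ σ h (BeurlingSpace.incl U τ σ φ)).toReal}

/-! ### The Roumieu space `D_{{τ,σ}}(U) = ind lim_K ind lim_{h → ∞} D^K_{τ,σ,h}` -/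

/-- Smooth functions with compact support in `U` for which the norm is finite for some `h > 0`. -/
def roumieuSubmodule (U : Opens (EuclideanSpace ℝ (Fin d))) (τ σ : ℝ) (hτ : 0 < τ) :
    Submodule ℂ 𝓓(U, ℂ) where
  carrier := {φ | ∃ h : ℝ, 0 < h ∧ ultraNorm τ σ h φ < ∞}
  add_mem' := by
    rintro φ ψ ⟨h₁, hh₁, h1⟩ ⟨h₂, hh₂, h2⟩
    have hm : 0 < max h₁ h₂ := lt_max_of_lt_left hh₁
    refine ⟨max h₁ h₂, hm, (ultraNorm_add_le τ σ hm.le _ _).trans_lt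
      (ENNReal.add_lt_top.2 ⟨?_, ?_⟩)⟩
    · exact (ultraNorm_mono hτ le_rfl hh₁ (le_max_left _ _) _).trans_lt h1
    · exact (ultraNorm_mono hτ le_rfl hh₂ (le_max_right _ _) _).trans_lt h2
  zero_mem' := ⟨1, one_pos, by simp [ultraNorm_zero]⟩
  smul_mem' := by
    rintro c φ ⟨h, hh, h1⟩
    exact ⟨h, hh, (ultraNorm_smul_le τ σ h c _).trans_lt
      (ENNReal.mul_lt_top ENNReal.ofReal_lt_top h1)⟩

/-- `D_{{τ,σ}}(U)`. -/
def RoumieuSpace (U : Opens (EuclideanSpace ℝ (Fin d))) (τ σ : ℝ) (hτ : 0 < τ) : Type :=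
  roumieuSubmodule U τ σ hτ

instance (τ σ : ℝ) (hτ : 0 < τ) : AddCommGroup (RoumieuSpace U τ σ hτ) :=
  inferInstanceAs (AddCommGroup (roumieuSubmodule U τ σ hτ))

instance (τ σ : ℝ) (hτ : 0 < τ) : Module ℂ (RoumieuSpace U τ σ hτ) :=
  inferInstanceAs (Module ℂ (roumieuSubmodule U τ σ hτ))

/-- The inclusion `D_{{τ,σ}}(U) → C_c^∞(U)`. -/
def RoumieuSpace.incl (U : Opens (EuclideanSpace ℝ (Fin d))) (τ σ : ℝ) (hτ : 0 < τ) :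
    RoumieuSpace U τ σ hτ →ₗ[ℂ] 𝓓(U, ℂ) :=
  (roumieuSubmodule U τ σ hτ).subtype

/-- The locally convex inductive limit topology over compact `K ⊆ U` and `h > 0`: it is generated
by all seminorms whose restriction to each normed space `D^K_{τ,σ,h}` is continuous. -/
instance (τ σ : ℝ) (hτ : 0 < τ) : TopologicalSpace (RoumieuSpace U τ σ hτ) :=
  seminormTopology {p | ∀ K : Compacts (EuclideanSpace ℝ (Fin d)),
    (K : Set (EuclideanSpace ℝ (Fin d))) ⊆ U →
    ∀ h : ℝ, 0 < h → ∃ C : ℝ, ∀ φ : RoumieuSpace U τ σ hτ,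
      tsupport (RoumieuSpace.incl U τ σ hτ φ) ⊆ K →
      ultraNorm τ σ h (RoumieuSpace.incl U τ σ hτ φ) < ∞ →
      p φ ≤ C * (ultraNorm τ σ h (RoumieuSpace.incl U τ σ hτ φ)).toReal}

/-! ### The space `D^{(σ)}(U) = proj lim_{τ → 0} D_{(τ,σ)}(U)` -/

/-- The intersection of all `D_{(τ,σ)}(U)`, `τ > 0`. -/
def beurlingLimitSubmodule (U : Opens (EuclideanSpace ℝ (Fin d))) (σ : ℝ) :
    Submodule ℂ 𝓓(U, ℂ) :=
  ⨅ (τ : ℝ) (_ : 0 < τ), beurlingSubmodule U τ σ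

/-- `D^{(σ)}(U)`. -/
def BeurlingLimitSpace (U : Opens (EuclideanSpace ℝ (Fin d))) (σ : ℝ) : Type :=
  beurlingLimitSubmodule U σ

instance (σ : ℝ) : AddCommGroup (BeurlingLimitSpace U σ) :=
  inferInstanceAs (AddCommGroup (beurlingLimitSubmodule U σ))

instance (σ : ℝ) : Module ℂ (BeurlingLimitSpace U σ) :=
  inferInstanceAs (Module ℂ (beurlingLimitSubmodule U σ))

/-- The inclusion `D^{(σ)}(U) → C_c^∞(U)`. -/
def BeurlingLimitSpace.incl (U : Opens (EuclideanSpace ℝ (Fin d))) (σ : ℝ) :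
    BeurlingLimitSpace U σ →ₗ[ℂ] 𝓓(U, ℂ) :=
  (beurlingLimitSubmodule U σ).subtype

/-- The inclusion `D^{(σ)}(U) → D_{(τ,σ)}(U)`, `τ > 0`. -/
def BeurlingLimitSpace.toBeurling (U : Opens (EuclideanSpace ℝ (Fin d))) (τ σ : ℝ)
    (hτ : 0 < τ) : BeurlingLimitSpace U σ →ₗ[ℂ] BeurlingSpace U τ σ :=
  Submodule.inclusion (iInf₂_le τ hτ)

/-- The projective limit topology. -/
instance (σ : ℝ) : TopologicalSpace (BeurlingLimitSpace U σ) :=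
  ⨅ (τ : ℝ) (hτ : 0 < τ), TopologicalSpace.induced
    (BeurlingLimitSpace.toBeurling U τ σ hτ) inferInstance

/-! ### The space `D^{{σ}}(U) = ind lim_{τ → ∞} D_{{τ,σ}}(U)` -/

/-- The union of all `D_{{τ,σ}}(U)`, `τ > 0`. -/
def roumieuLimitSubmodule (U : Opens (EuclideanSpace ℝ (Fin d))) (σ : ℝ) :
    Submodule ℂ 𝓓(U, ℂ) where
  carrier := {φ | ∃ (τ : ℝ) (hτ : 0 < τ), φ ∈ roumieuSubmodule U τ σ hτ}
  add_mem' := by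
    rintro φ ψ ⟨τ₁, hτ₁, h₁, hh₁, h1⟩ ⟨τ₂, hτ₂, h₂, hh₂, h2⟩
    refine ⟨max τ₁ τ₂, lt_max_of_lt_left hτ₁, Submodule.add_mem _ ⟨h₁, hh₁, ?_⟩ ⟨h₂, hh₂, ?_⟩⟩
    · exact (ultraNorm_mono hτ₁ (le_max_left _ _) hh₁ le_rfl _).trans_lt h1
    · exact (ultraNorm_mono hτ₂ (le_max_right _ _) hh₂ le_rfl _).trans_lt h2
  zero_mem' := ⟨1, one_pos, Submodule.zero_mem _⟩
  smul_mem' := by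
    rintro c φ ⟨τ, hτ, h⟩
    exact ⟨τ, hτ, Submodule.smul_mem _ c h⟩

/-- `D^{{σ}}(U)`. -/
def RoumieuLimitSpace (U : Opens (EuclideanSpace ℝ (Fin d))) (σ : ℝ) : Type :=
  roumieuLimitSubmodule U σ

instance (σ : ℝ) : AddCommGroup (RoumieuLimitSpace U σ) :=
  inferInstanceAs (AddCommGroup (roumieuLimitSubmodule U σ))

instance (σ : ℝ) : Module ℂ (RoumieuLimitSpace U σ) :=
  inferInstanceAs (Module ℂ (roumieuLimitSubmodule U σ))

/-- The inclusion `D^{{σ}}(U) → C_c^∞(U)`. -/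
def RoumieuLimitSpace.incl (U : Opens (EuclideanSpace ℝ (Fin d))) (σ : ℝ) :
    RoumieuLimitSpace U σ →ₗ[ℂ] 𝓓(U, ℂ) :=
  (roumieuLimitSubmodule U σ).subtype

/-- The inclusion `D_{{τ,σ}}(U) → D^{{σ}}(U)`, `τ > 0`. -/
def RoumieuLimitSpace.ofRoumieu (U : Opens (EuclideanSpace ℝ (Fin d))) (τ σ : ℝ)
    (hτ : 0 < τ) : RoumieuSpace U τ σ hτ →ₗ[ℂ] RoumieuLimitSpace U σ :=
  Submodule.inclusion (fun _ hφ => ⟨τ, hτ, hφ⟩)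

/-- The locally convex inductive limit topology: it is generated by all seminorms whose
restriction to each `D_{{τ,σ}}(U)` is continuous. -/
instance (σ : ℝ) : TopologicalSpace (RoumieuLimitSpace U σ) :=
  seminormTopology {p | ∀ (τ : ℝ) (hτ : 0 < τ),
    Continuous (fun φ : RoumieuSpace U τ σ hτ => p (RoumieuLimitSpace.ofRoumieu U τ σ hτ φ))}

/-! ### Wedges and boundary values -/

/-- The point `x + i y` of `ℂ^d`. -/
def cpoint (x y : EuclideanSpace ℝ (Fin d)) : EuclideanSpace ℂ (Fin d) :=
  WithLp.toLp 2 (fun j => (x j : ℂ) + (y j : ℂ) * Complex.I)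

/-- The wedge `{x + i y | x ∈ U, y ∈ Γ, |y| < γ}` in `ℂ^d`. -/
def wedge (U : Opens (EuclideanSpace ℝ (Fin d))) (Γ : Set (EuclideanSpace ℝ (Fin d))) (γ : ℝ) :
    Set (EuclideanSpace ℂ (Fin d)) :=
  {z | ∃ x ∈ U, ∃ y ∈ Γ, ‖y‖ < γ ∧ z = cpoint x y}

/-- Let `X` be a topological vector space of test functions on `U`, included in `C_c^∞(U)` by `j`.
The functions `x ↦ F (x + i y)`, `y ∈ Γ`, `|y| < γ`, define elements of the dual of `X`, and these
converge in the dual of `X` as `y → 0`, `y ∈ Γ`. Here `X →L[ℂ] ℂ` carries the strong dual topology,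
that of uniform convergence on the bounded subsets of `X`. -/
def HasBoundaryValue {X : Type*} [AddCommGroup X] [Module ℂ X] [TopologicalSpace X]
    (j : X →ₗ[ℂ] 𝓓(U, ℂ)) (Γ : Set (EuclideanSpace ℝ (Fin d))) (γ : ℝ)
    (F : EuclideanSpace ℂ (Fin d) → ℂ) : Prop :=
  ∃ f : EuclideanSpace ℝ (Fin d) → (X →L[ℂ] ℂ),
    (∀ y ∈ Γ, ‖y‖ < γ → ∀ φ : X, f y φ = ∫ x, F (cpoint x y) * j φ x) ∧
    ∃ u : X →L[ℂ] ℂ, Tendsto f (𝓝[Γ] 0) (𝓝 u)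

end TestSpaces

end ExtGevrey

end

noncomputable section

namespace ExtGevrey

/-! ### The sequences of radii and bounds attached to the associated function -/

/-! Write `ψ(x) = x ^ σ log x`. The weights are `exp (n ^ σ log h + τ ψ(n))`, and both growth
hypotheses reduce to one condition, `HasGrowth`: near the edge `|F(x + iy)|` is at most a constant
times the exponential of the Legendre transform of `b ψ` at `log (1 / |y|)`, recorded along the
radii `exp (-b ψ'(n))`. The theorem then rests on `τ < b` alone. The parameters `h` and `H` only
contribute multiples of `n ^ σ`, which is negligible against `ψ(n)`.

No almost analytic extension is built. Along a ray `s w` in the cone, Cauchy–Riemann and integration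
by parts (`hasFDerivAt_pairing`) show that the pairing of `F(· + i s w)` with a test function has
`k`-th derivative `(-i) ^ k` times the pairing with the `k`-th derivative of that function in the
direction `w`. So a function of `s` is given whose derivatives grow like the weights in `k` and like
the bound on `F` in `s`. In `norm_le_of_derivatives_growth` its value at `s` is reached through
Taylor polynomials centred at `s + u`, with the degree rising as `u` descends through the radii. The
errors form the series in `summable_weight`, whose exponents are asymptotic to `(τ - b) ψ(n)`. Hence
the pairings are bounded uniformly as `y → 0`.

Applied to a first derivative of the test function, the same argument (`summable_weight_succ`)
bounds the gradient in `y`. On a connected open cone this gives a limit `u` with error at most `C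
|y|` (`exists_limit_at_apex`). The supremum over `y` of `|f y φ - u φ| / |y|` is therefore a
continuous seminorm, so convergence is uniform on bounded sets (`hasBoundaryValue_of_hasGrowth`). -/

/-- `log (n ^ (n ^ σ))`, the logarithm of the weight with `τ = h = 1`. -/
def logWeight (σ : ℝ) (n : ℕ) : ℝ := (n : ℝ) ^ σ * Real.log n

/-- The derivative of `x ^ σ * log x` at `n`. -/
def slope (σ : ℝ) (n : ℕ) : ℝ :=
  σ * ((n : ℝ) ^ (σ - 1) * Real.log n) + (n : ℝ) ^ (σ - 1)

lemma logWeight_nonneg (σ : ℝ) (n : ℕ) : 0 ≤ logWeight σ n :=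
  mul_nonneg (by positivity) (Real.log_natCast_nonneg n)

lemma slope_nonneg {σ : ℝ} (hσ : 1 < σ) (n : ℕ) : 0 ≤ slope σ n :=
  add_nonneg (mul_nonneg (by linarith) (mul_nonneg (by positivity) (Real.log_natCast_nonneg n)))
    (by positivity)

lemma logWeight_zero (σ : ℝ) : logWeight σ 0 = 0 := by simp [logWeight]

lemma slope_zero {σ : ℝ} (hσ : 1 < σ) : slope σ 0 = 0 := by
  simp [slope, Real.zero_rpow (sub_pos.2 hσ).ne']

lemma nat_mul_slope {σ : ℝ} (hσ : 1 < σ) (n : ℕ) :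
    n * slope σ n = σ * logWeight σ n + (n : ℝ) ^ σ := by
  rcases Nat.eq_zero_or_pos n with rfl | hn
  · simp [logWeight, Real.zero_rpow (by linarith : σ ≠ 0)]
  · have hn' : (0 : ℝ) < n := by exact_mod_cast hn
    unfold slope logWeight
    rw [Real.rpow_sub_one hn'.ne']
    field_simp

/-- `x ^ σ * log x` lies above its tangents at natural numbers. -/
lemma logWeight_tangent {σ : ℝ} (hσ : 1 < σ) (N p : ℕ) :
    p * slope σ N - logWeight σ p ≤ N * slope σ N - logWeight σ N := by
  rcases Nat.eq_zero_or_pos N with rfl | hN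
  · simpa [slope_zero hσ, logWeight_zero] using logWeight_nonneg σ p
  have hN0 : (0 : ℝ) < N := by exact_mod_cast hN
  rcases Nat.eq_zero_or_pos p with rfl | hp
  · rw [nat_mul_slope hσ, logWeight_zero]
    have := logWeight_nonneg σ N
    have : (0 : ℝ) ≤ (N : ℝ) ^ σ := by positivity
    simp only [Nat.cast_zero]
    nlinarith
  have hp0 : (0 : ℝ) < p := by exact_mod_cast hp
  -- After scaling by `N`, the tangent inequality splits into Bernoulli's inequality `h1`, with
  -- coefficient `log N`, and `h2`, without it.
  set x : ℝ := p / N with hx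
  have hx0 : 0 < x := by positivity
  have hpx : (p : ℝ) = x * N := by rw [hx]; field_simp
  have h1 : σ * (x - 1) ≤ x ^ σ - 1 := by
    have := one_add_mul_self_le_rpow_one_add (s := x - 1) (by linarith) hσ.le
    rw [add_sub_cancel] at this
    linarith
  have h2 : x - 1 ≤ x ^ σ * Real.log x := by
    have h3 : x - 1 ≤ x * Real.log x := by
      have := Real.one_sub_inv_le_log_of_pos hx0
      have h4 := mul_le_mul_of_nonneg_left this hx0.le
      rwa [mul_sub, mul_one, mul_inv_cancel₀ hx0.ne'] at h4
    refine h3.trans ?_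
    rcases le_total 1 x with h | h
    · exact mul_le_mul_of_nonneg_right
        (by simpa using Real.rpow_le_rpow_of_exponent_le h hσ.le) (Real.log_nonneg h)
    · exact mul_le_mul_of_nonpos_right
        (by simpa using Real.rpow_le_rpow_of_exponent_ge hx0 h hσ.le)
        (Real.log_nonpos hx0.le h)
  have hl : 0 ≤ Real.log N := Real.log_natCast_nonneg N
  have e1 : logWeight σ p = (N : ℝ) ^ σ * (x ^ σ * (Real.log x + Real.log N)) := by
    unfold logWeight
    rw [hpx, Real.mul_rpow hx0.le hN0.le, Real.log_mul hx0.ne' hN0.ne']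
    ring
  have e2 : p * slope σ N = x * (σ * logWeight σ N + (N : ℝ) ^ σ) := by
    rw [hpx, mul_assoc, nat_mul_slope hσ]
  rw [e1, e2, nat_mul_slope hσ]
  unfold logWeight
  have hNs : (0 : ℝ) < (N : ℝ) ^ σ := by positivity
  nlinarith [mul_nonneg hNs.le (mul_nonneg hl (sub_nonneg.2 h1)),
    mul_nonneg hNs.le (sub_nonneg.2 h2)]

lemma slope_mono {σ : ℝ} (hσ : 1 < σ) : Monotone (slope σ) := by
  refine monotone_nat_of_le_succ fun n => ?_
  unfold slope
  have h0 : 0 ≤ Real.log n := Real.log_natCast_nonneg n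
  have h1 : Real.log n ≤ Real.log ((n + 1 : ℕ) : ℝ) := by
    rcases Nat.eq_zero_or_pos n with rfl | hn
    · simp
    · exact Real.log_le_log (by exact_mod_cast hn) (by push_cast; linarith)
  have h2 : (n : ℝ) ^ (σ - 1) ≤ ((n + 1 : ℕ) : ℝ) ^ (σ - 1) :=
    Real.rpow_le_rpow (by positivity) (by push_cast; linarith) (by linarith)
  gcongr

lemma tendsto_slope {σ : ℝ} (hσ : 1 < σ) : Tendsto (slope σ) atTop atTop := by
  refine tendsto_atTop_mono (fun n => ?_)
    ((tendsto_rpow_atTop (sub_pos.2 hσ)).comp tendsto_natCast_atTop_atTop)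
  have := Real.log_natCast_nonneg n
  simp only [Function.comp_apply, slope, le_add_iff_nonneg_left]
  have : 0 < σ := by linarith
  positivity

/-- The radii `exp (-b ψ'(n))`, `ψ(x) = x ^ σ log x`. -/
def radius (σ b : ℝ) (n : ℕ) : ℝ := Real.exp (-(b * slope σ n))

/-- The Legendre transform of `b ψ`, `ψ(x) = x ^ σ log x`, at `b ψ'(n)`, exponentiated. -/
def growth (σ b : ℝ) (n : ℕ) : ℝ := Real.exp (b * (n * slope σ n - logWeight σ n))

lemma radius_pos (σ b : ℝ) (n : ℕ) : 0 < radius σ b n := Real.exp_pos _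

lemma growth_nonneg (σ b : ℝ) (n : ℕ) : 0 ≤ growth σ b n := (Real.exp_pos _).le

lemma radius_anti {σ b : ℝ} (hσ : 1 < σ) (hb : 0 < b) : Antitone (radius σ b) := fun _ _ h =>
  Real.exp_le_exp.2 (neg_le_neg (mul_le_mul_of_nonneg_left (slope_mono hσ h) hb.le))

lemma radius_le_one {σ b : ℝ} (hσ : 1 < σ) (hb : 0 < b) (n : ℕ) : radius σ b n ≤ 1 :=
  Real.exp_le_one_iff.2 (neg_nonpos.2 (mul_nonneg hb.le (slope_nonneg hσ n)))

lemma tendsto_radius {σ b : ℝ} (hσ : 1 < σ) (hb : 0 < b) :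
    Tendsto (radius σ b) atTop (𝓝 0) :=
  Real.tendsto_exp_neg_atTop_nhds_zero.comp ((tendsto_slope hσ).const_mul_atTop hb)

/-- Since `log (1 / t) ≤ b ψ'(n)`, the tangent at `n` controls every term of the Legendre transform
at once. This turns a bound by an unknown exponent `p` into one depending only on the radius. -/
lemma exp_le_growth {σ b t : ℝ} (hσ : 1 < σ) (hb : 0 < b) {n : ℕ} (ht : radius σ b n ≤ t)
    (p : ℕ) : Real.exp (p * Real.log (1 / t) - b * logWeight σ p) ≤ growth σ b n := by
  refine Real.exp_le_exp.2 ?_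
  have ht0 := (radius_pos σ b n).trans_le ht
  have h1 : Real.log (1 / t) ≤ b * slope σ n := by
    have := Real.log_le_log (radius_pos σ b n) ht
    rw [radius, Real.log_exp] at this
    rw [one_div, Real.log_inv]
    linarith
  calc p * Real.log (1 / t) - b * logWeight σ p
      ≤ p * (b * slope σ n) - b * logWeight σ p := by gcongr
    _ = b * (p * slope σ n - logWeight σ p) := by ring
    _ ≤ _ := mul_le_mul_of_nonneg_left (logWeight_tangent hσ n p) hb.le

/-! ### Summability -/

lemma tendsto_rpow_succ_div (σ : ℝ) :
    Tendsto (fun n : ℕ => ((n + 1 : ℕ) : ℝ) ^ σ / (n : ℝ) ^ σ) atTop (𝓝 1) := by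
  have h1 : Tendsto (fun n : ℕ => 1 + 1 / (n : ℝ)) atTop (𝓝 1) := by
    simpa using tendsto_one_div_atTop_nhds_zero_nat.const_add (1 : ℝ)
  have h2 := h1.rpow_const (p := σ) (Or.inl one_ne_zero)
  rw [Real.one_rpow] at h2
  refine h2.congr' ?_
  filter_upwards [eventually_gt_atTop 0] with n hn
  have hn' : (0 : ℝ) < n := by exact_mod_cast hn
  rw [← Real.div_rpow (by positivity) (by positivity)]
  congr 1
  push_cast
  field_simp

lemma tendsto_log_succ_div :
    Tendsto (fun n : ℕ => Real.log ((n + 1 : ℕ) : ℝ) / Real.log n) atTop (𝓝 1) := by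
  have h1 : Tendsto (fun n : ℕ => 1 + Real.log (1 + 1 / (n : ℝ)) / Real.log n) atTop
      (𝓝 (1 + 0)) := by
    refine tendsto_const_nhds.add ?_
    refine Tendsto.div_atTop (a := Real.log 1) ?_
      (Real.tendsto_log_atTop.comp tendsto_natCast_atTop_atTop)
    have h1 : Tendsto (fun n : ℕ => 1 + 1 / (n : ℝ)) atTop (𝓝 1) := by
      simpa using tendsto_one_div_atTop_nhds_zero_nat.const_add (1 : ℝ)
    exact h1.log one_ne_zero
  rw [add_zero] at h1
  refine h1.congr' ?_
  filter_upwards [eventually_gt_atTop 1] with n hn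
  have hn' : (1 : ℝ) < n := by exact_mod_cast hn
  have hl : 0 < Real.log n := Real.log_pos hn'
  have : ((n + 1 : ℕ) : ℝ) = n * (1 + 1 / n) := by push_cast; field_simp
  rw [this, Real.log_mul (by positivity) (by positivity)]
  field_simp

lemma tendsto_logWeight_succ_div (σ : ℝ) :
    Tendsto (fun n : ℕ => logWeight σ (n + 1) / logWeight σ n) atTop (𝓝 1) := by
  have := (tendsto_rpow_succ_div σ).mul tendsto_log_succ_div
  rw [one_mul] at this
  refine this.congr fun n => ?_
  rw [div_mul_div_comm, logWeight, logWeight]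

lemma tendsto_rpow_div_logWeight {σ : ℝ} :
    Tendsto (fun n : ℕ => (n : ℝ) ^ σ / logWeight σ n) atTop (𝓝 0) := by
  refine (Real.tendsto_log_atTop.comp tendsto_natCast_atTop_atTop).inv_tendsto_atTop.congr' ?_
  filter_upwards [eventually_gt_atTop 1] with n hn
  have hn' : (1 : ℝ) < n := by exact_mod_cast hn
  have hl : 0 < Real.log n := Real.log_pos hn'
  have : 0 < (n : ℝ) ^ σ := by positivity
  simp only [Pi.inv_apply, Function.comp_apply, logWeight]
  field_simp

lemma tendsto_rpow_succ_div_logWeight {σ : ℝ} :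
    Tendsto (fun n : ℕ => ((n + 1 : ℕ) : ℝ) ^ σ / logWeight σ n) atTop (𝓝 0) := by
  have := (tendsto_rpow_succ_div σ).mul (tendsto_rpow_div_logWeight (σ := σ))
  rw [mul_zero] at this
  refine this.congr' ?_
  filter_upwards [eventually_gt_atTop 0] with n hn
  have : (0 : ℝ) < (n : ℝ) ^ σ := Real.rpow_pos_of_pos (by exact_mod_cast hn) _
  field_simp

lemma tendsto_natCast_div_logWeight {σ : ℝ} (hσ : 1 < σ) :
    Tendsto (fun n : ℕ => (n : ℝ) / logWeight σ n) atTop (𝓝 0) := by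
  refine squeeze_zero (fun n => div_nonneg (by positivity) (logWeight_nonneg σ n)) (fun n => ?_)
    (tendsto_rpow_div_logWeight (σ := σ))
  refine div_le_div_of_nonneg_right ?_ (logWeight_nonneg σ n)
  rcases Nat.eq_zero_or_pos n with rfl | hn
  · simp [Real.zero_rpow (by linarith : σ ≠ 0)]
  · simpa using Real.rpow_le_rpow_of_exponent_le
      (by exact_mod_cast hn : (1 : ℝ) ≤ n) hσ.le

lemma weight_eq_exp {τ σ h : ℝ} (hσ : 1 < σ) (hh : 0 < h) (n : ℕ) :
    weight τ σ h n = Real.exp ((n : ℝ) ^ σ * Real.log h + τ * logWeight σ n) := by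
  have hσ0 : σ ≠ 0 := by linarith
  rcases Nat.eq_zero_or_pos n with rfl | hn
  · simp [weight, logWeight, Real.zero_rpow hσ0]
  · have hn' : (0 : ℝ) < n := by exact_mod_cast hn
    rw [weight, logWeight, Real.exp_add, Real.rpow_def_of_pos hh,
      Real.rpow_def_of_pos hn' (τ * _)]
    congr 2 <;> ring

lemma weight_pos {τ σ h : ℝ} (hσ : 1 < σ) (hh : 0 < h) (n : ℕ) : 0 < weight τ σ h n := by
  rw [weight_eq_exp hσ hh]; exact Real.exp_pos _

lemma weight_zero {τ σ h : ℝ} (hσ : 1 < σ) (hh : 0 < h) : weight τ σ h 0 = 1 := by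
  rw [weight_eq_exp hσ hh]; simp [logWeight_zero, Real.zero_rpow (by linarith : σ ≠ 0)]

/-- As `n` is negligible against `logWeight σ n`, eventually `E n ≤ -n`, and a geometric series
dominates. -/
lemma summable_of_exponent {E : ℕ → ℝ} {σ c : ℝ} (hσ : 1 < σ) (hc : c < 0)
    (hE : Tendsto (fun n => E n / logWeight σ n) atTop (𝓝 c)) :
    Summable fun n => Real.exp (E n) := by
  have h1 : Tendsto (fun n => (E n + n) / logWeight σ n) atTop (𝓝 (c + 0)) := by
    simpa only [add_div] using hE.add (tendsto_natCast_div_logWeight hσ)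
  rw [add_zero] at h1
  have h2 := h1.eventually (gt_mem_nhds hc)
  refine Summable.of_norm_bounded_eventually_nat Real.summable_exp_neg_nat ?_
  filter_upwards [h2, eventually_gt_atTop 1] with n hn h1n
  have hpos : 0 < logWeight σ n := by
    have : (1 : ℝ) < n := by exact_mod_cast h1n
    exact mul_pos (Real.rpow_pos_of_pos (by linarith) _) (Real.log_pos this)
  rw [Real.norm_eq_abs, Real.abs_exp, Real.exp_le_exp]
  have := (div_neg_iff.1 hn).resolve_left (fun h => absurd h.2 hpos.le.not_gt)
  linarith [this.1]

/-- This is where `τ < b` decides. Dividing the exponent by `ψ(n)`, the weight contributes `τ`, the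
power of the radius `-b σ`, and the growth factor `b (σ - 1)`, in total `τ - b`. Passing from `n` to
`n + 1` is harmless because `ψ(n + 1) / ψ(n) → 1`; the terms in `D` and `h` vanish in the limit. -/
lemma summable_weight {τ σ h b D : ℝ} (hσ : 1 < σ) (hh : 0 < h) (hD : 0 < D) (hb : τ < b) :
    Summable fun n : ℕ =>
      D ^ n * weight τ σ h n * radius σ b n ^ n * growth σ b (n + 1) := by
  have key : ∀ n : ℕ, D ^ n * weight τ σ h n * radius σ b n ^ n * growth σ b (n + 1) =
      Real.exp (n * Real.log D + ((n : ℝ) ^ σ * Real.log h + τ * logWeight σ n)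
        - b * (σ * logWeight σ n + (n : ℝ) ^ σ)
        + b * (σ * logWeight σ (n + 1) + ((n + 1 : ℕ) : ℝ) ^ σ - logWeight σ (n + 1))) := by
    intro n
    rw [weight_eq_exp hσ hh, radius, ← Real.exp_nat_mul, growth, nat_mul_slope hσ,
      ← Real.rpow_natCast D n, Real.rpow_def_of_pos hD, ← Real.exp_add, ← Real.exp_add,
      ← Real.exp_add]
    congr 1
    have := nat_mul_slope hσ n
    linear_combination (-b) * this
  simp_rw [key]
  refine summable_of_exponent (c := τ - b) hσ (by linarith) ?_
  have h1 := (tendsto_natCast_div_logWeight hσ).mul_const (Real.log D)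
  have h2 := (tendsto_rpow_div_logWeight (σ := σ)).mul_const (Real.log h - b)
  have h3 := (tendsto_logWeight_succ_div σ).mul_const (b * (σ - 1))
  have h4 := (tendsto_rpow_succ_div_logWeight (σ := σ)).mul_const b
  have h5 := (((h1.add h2).add h3).add h4).add_const (τ - b * σ)
  have e : 0 * Real.log D + 0 * (Real.log h - b) + 1 * (b * (σ - 1)) + 0 * b + (τ - b * σ)
      = τ - b := by ring
  rw [e] at h5
  refine h5.congr' ?_
  filter_upwards [eventually_gt_atTop 1] with n h1n
  have hpos : 0 < logWeight σ n := by
    have : (1 : ℝ) < n := by exact_mod_cast h1n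
    exact mul_pos (Real.rpow_pos_of_pos (by linarith) _) (Real.log_pos this)
  field_simp
  ring

/-- Shifting the index of the weight pays for one extra derivative of the test function. The
limiting exponent is still `τ - b`, so differentiation costs nothing. -/
lemma summable_weight_succ {τ σ h b D : ℝ} (hσ : 1 < σ) (hh : 0 < h) (hD : 0 < D) (hb : τ < b) :
    Summable fun n : ℕ =>
      D ^ (n + 1) * weight τ σ h (n + 1) * radius σ b n ^ n * growth σ b (n + 1) := by
  have key : ∀ n : ℕ,
      D ^ (n + 1) * weight τ σ h (n + 1) * radius σ b n ^ n * growth σ b (n + 1) =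
      D * Real.exp (n * Real.log D
        + (((n + 1 : ℕ) : ℝ) ^ σ * Real.log h + τ * logWeight σ (n + 1))
        - b * (σ * logWeight σ n + (n : ℝ) ^ σ)
        + b * (σ * logWeight σ (n + 1) + ((n + 1 : ℕ) : ℝ) ^ σ - logWeight σ (n + 1))) := by
    intro n
    rw [weight_eq_exp hσ hh, radius, ← Real.exp_nat_mul, growth, nat_mul_slope hσ, pow_succ' D,
      ← Real.rpow_natCast D n, Real.rpow_def_of_pos hD, mul_assoc, mul_assoc, mul_assoc,
      ← Real.exp_add, ← Real.exp_add, ← Real.exp_add]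
    congr 2
    have := nat_mul_slope hσ n
    linear_combination (-b) * this
  simp_rw [key]
  refine (summable_of_exponent (c := τ - b) hσ (by linarith) ?_).mul_left D
  have h1 := (tendsto_natCast_div_logWeight hσ).mul_const (Real.log D)
  have h2 := (tendsto_rpow_div_logWeight (σ := σ)).mul_const (-b)
  have h3 := (tendsto_logWeight_succ_div σ).mul_const (τ + b * (σ - 1))
  have h4 := (tendsto_rpow_succ_div_logWeight (σ := σ)).mul_const (Real.log h + b)
  have h5 := (((h1.add h2).add h3).add h4).add_const (-(b * σ))
  have e : 0 * Real.log D + 0 * (-b) + 1 * (τ + b * (σ - 1)) + 0 * (Real.log h + b) + -(b * σ)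
      = τ - b := by ring
  rw [e] at h5
  refine h5.congr' ?_
  filter_upwards [eventually_gt_atTop 1] with n h1n
  have hpos : 0 < logWeight σ n := by
    have : (1 : ℝ) < n := by exact_mod_cast h1n
    exact mul_pos (Real.rpow_pos_of_pos (by linarith) _) (Real.log_pos this)
  field_simp
  ring

/-! ### A one-variable estimate by Taylor expansions of varying degree -/

/-- The Taylor polynomial of degree `< n` of `G 0` at `s + u`, evaluated at `s`, where `G k` stands
for the `k`-th derivative of `G 0`. -/
def backTaylor (G : ℕ → ℝ → ℂ) (s : ℝ) (n : ℕ) (u : ℝ) : ℂ :=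
  ∑ k ∈ Finset.range n, (-(u : ℂ)) ^ k / (k.factorial : ℂ) * G k (s + u)

lemma backTaylor_zero (G : ℕ → ℝ → ℂ) (s : ℝ) {n : ℕ} (hn : 0 < n) :
    backTaylor G s n 0 = G 0 s := by
  obtain ⟨m, rfl⟩ := Nat.exists_eq_succ_of_ne_zero hn.ne'
  rw [backTaylor, Finset.sum_range_succ']
  simp

/-- Moving the centre of a Taylor polynomial telescopes: only the top-order term survives. -/
lemma hasDerivAt_backTaylor {G : ℕ → ℝ → ℂ} {s u : ℝ}
    (hG : ∀ k, HasDerivAt (G k) (G (k + 1) (s + u)) (s + u)) (n : ℕ) :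
    HasDerivAt (backTaylor G s (n + 1))
      ((-(u : ℂ)) ^ n / (n.factorial : ℂ) * G (n + 1) (s + u)) u := by
  have hG' : ∀ k, HasDerivAt (fun u => G k (s + u)) (G (k + 1) (s + u)) u := fun k =>
    (hG k).comp_const_add s u
  induction n with
  | zero =>
    have : backTaylor G s (0 + 1) = fun u => G 0 (s + u) := by
      funext v; simp [backTaylor]
    rw [this]
    simpa using hG' 0
  | succ n ih =>
    have e : backTaylor G s (n + 1 + 1) = fun u => backTaylor G s (n + 1) u +
        (-(u : ℂ)) ^ (n + 1) / ((n + 1).factorial : ℂ) * G (n + 1) (s + u) := by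
      funext v; exact Finset.sum_range_succ _ _
    rw [e]
    have h1 : HasDerivAt (fun u : ℝ => -(u : ℂ)) (-1) u := (Complex.ofRealCLM.hasDerivAt).neg
    have h2 := ((h1.pow (n + 1)).div_const ((n + 1).factorial : ℂ)).mul (hG' (n + 1))
    refine (ih.add h2).congr_deriv ?_
    have : (n.factorial : ℂ) ≠ 0 := by exact_mod_cast n.factorial_ne_zero
    have : (n + 1 : ℂ) ≠ 0 := by exact_mod_cast n.succ_ne_zero
    simp only [Nat.factorial_succ, Nat.add_sub_cancel, Pi.pow_apply]
    push_cast
    field_simp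
    ring

lemma norm_pow_div_factorial_le {u : ℝ} (hu : 0 ≤ u) (k : ℕ) :
    ‖(-(u : ℂ)) ^ k / (k.factorial : ℂ)‖ ≤ u ^ k := by
  rw [norm_div, norm_pow, norm_neg, Complex.norm_real, Real.norm_of_nonneg hu, Complex.norm_natCast]
  exact div_le_self (by positivity) (by exact_mod_cast k.factorial_pos)

/-- The mean value inequality for the single surviving term. The factorial is discarded, since the
weights dominate it anyway. -/
lemma norm_backTaylor_sub_le {G : ℕ → ℝ → ℂ} {s r a c C : ℝ} {n : ℕ} (ha : 0 ≤ a) (hac : a ≤ c)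
    (hs : 0 < s + a) (hr : s + c < r)
    (hG : ∀ k, ∀ v, 0 < v → v < r → HasDerivAt (G k) (G (k + 1) v) v)
    (hC : ∀ v, s + a ≤ v → v < r → ‖G (n + 1) v‖ ≤ C) :
    ‖backTaylor G s (n + 1) a - backTaylor G s (n + 1) c‖ ≤ c ^ (n + 1) * C := by
  have hc : 0 ≤ c := ha.trans hac
  have hC0 : 0 ≤ C := (norm_nonneg _).trans (hC (s + c) (by linarith) hr)
  have hd : ∀ u ∈ Set.Icc a c, HasDerivWithinAt (backTaylor G s (n + 1))
      ((-(u : ℂ)) ^ n / (n.factorial : ℂ) * G (n + 1) (s + u)) (Set.Icc a c) u := fun u hu =>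
    (hasDerivAt_backTaylor (fun k => hG k _ (by linarith [hu.1]) (by linarith [hu.2]))
      n).hasDerivWithinAt
  have hb : ∀ u ∈ Set.Icc a c,
      ‖(-(u : ℂ)) ^ n / (n.factorial : ℂ) * G (n + 1) (s + u)‖ ≤ c ^ n * C := fun u hu => by
    have hu0 : 0 ≤ u := ha.trans hu.1
    rw [norm_mul]
    exact mul_le_mul ((norm_pow_div_factorial_le hu0 n).trans
      (pow_le_pow_left₀ hu0 hu.2 n))
      (hC _ (by linarith [hu.1]) (by linarith [hu.2])) (norm_nonneg _) (by positivity)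
  have := (convex_Icc a c).norm_image_sub_le_of_norm_hasDerivWithin_le hd hb
    (Set.right_mem_Icc.2 hac) (Set.left_mem_Icc.2 hac)
  refine this.trans ?_
  rw [Real.norm_eq_abs, abs_sub_comm, abs_of_nonneg (sub_nonneg.2 hac), pow_succ]
  calc c ^ n * C * (c - a) ≤ c ^ n * C * c := by gcongr; linarith
    _ = _ := by ring

/-- If `G k` is the `k`-th derivative of `G 0` on `(0, r)` and grows towards `0` like the sequence
`M` along the radii `t`, then `G 0` is bounded near `0`. -/
theorem norm_le_of_derivatives_growth {t M m : ℕ → ℝ} {r : ℝ} (ht : Antitone t)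
    (ht0 : ∀ n, 0 < t n) (ht1 : ∀ n, t n ≤ 1) (htl : Tendsto t atTop (𝓝 0)) (hM : ∀ n, 0 ≤ M n)
    (hm : ∀ n, 0 ≤ m n) (hs : Summable fun n => m n * t n ^ n * M (n + 1)) (hr : 0 < r) :
    ∃ C, 0 ≤ C ∧ ∀ (G : ℕ → ℝ → ℂ) (B : ℝ), 0 ≤ B →
      (∀ k, ∀ v, 0 < v → v < r → HasDerivAt (G k) (G (k + 1) v) v) →
      (∀ k n v, t n ≤ v → v < r → ‖G k v‖ ≤ B * m k * M n) →
      ∀ s, 0 < s → s < r / 2 → ‖G 0 s‖ ≤ C * B := by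
  -- From `N` on, centres `s + t n` stay below `r`. The extra `1` ensures `N ≥ 1`, so that the
  -- polynomials have at least the term of order zero.
  obtain ⟨N₀, hN₀⟩ := (htl.eventually (gt_mem_nhds (half_pos hr))).exists
  set N := N₀ + 1 with hN
  have htN : ∀ n, N ≤ n → t n < r / 2 := fun n hn => (ht (by omega)).trans_lt hN₀
  set a : ℕ → ℝ := fun n => m n * t n ^ n * M (n + 1) with ha
  have ha0 : ∀ n, 0 ≤ a n := fun n =>
    mul_nonneg (mul_nonneg (hm n) (pow_nonneg (ht0 n).le n)) (hM _)
  set C₁ := ∑ k ∈ Finset.range N, m k * M N with hC₁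
  have hC₁0 : 0 ≤ C₁ := Finset.sum_nonneg fun k _ => mul_nonneg (hm k) (hM N)
  have hS0 : 0 ≤ ∑' n, a n := tsum_nonneg ha0
  -- `C₁` bounds the initial polynomial. Two copies of the series pay for moving the centre and for
  -- raising the degree, the third for the final jump to `u = 0`.
  refine ⟨C₁ + 3 * ∑' n, a n, by positivity, fun G B hB hG hbd s hs0 hsr => ?_⟩
  -- Moving the centre at fixed degree. The condition on `s + c` keeps all centres at distance at
  -- least `t (n + 1)` from the edge, where `M (n + 1)` bounds `G`.
  have hstep : ∀ n, N ≤ n → ∀ c, 0 ≤ c → c ≤ t n → t (n + 1) ≤ s + c →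
      ‖backTaylor G s n c - backTaylor G s n (t n)‖ ≤ B * a n := by
    intro n hn c hc hct hsc
    obtain ⟨k, rfl⟩ : ∃ k, n = k + 1 := ⟨n - 1, by omega⟩
    have := norm_backTaylor_sub_le (G := G) (n := k) (C := B * m (k + 1) * M (k + 1 + 1)) hc hct
      (by linarith) (by linarith [htN _ hn]) hG
      (fun v hv hvr => hbd _ _ v (hsc.trans hv) hvr)
    refine this.trans (le_of_eq ?_)
    simp only [ha]
    ring
  have hJ : ∀ n, N ≤ n → ‖backTaylor G s n (t n)‖ ≤
      B * C₁ + 2 * B * ∑ k ∈ Finset.range n, a k := by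
    intro n hn
    induction n, hn using Nat.le_induction with
    | base =>
      have h1 : ‖backTaylor G s N (t N)‖ ≤ B * C₁ := by
        rw [backTaylor, hC₁, Finset.mul_sum]
        refine norm_sum_le_of_le _ fun k _ => ?_
        rw [norm_mul]
        have h1 : ‖(-(t N : ℂ)) ^ k / (k.factorial : ℂ)‖ ≤ 1 :=
          (norm_pow_div_factorial_le (ht0 N).le k).trans (pow_le_one₀ (ht0 N).le (ht1 N))
        have h2 := hbd k N (s + t N) (by linarith) (by linarith [htN N le_rfl])
        calc _ ≤ 1 * (B * m k * M N) := mul_le_mul h1 h2 (norm_nonneg _) zero_le_one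
          _ = _ := by ring
      have h2 : 0 ≤ ∑ k ∈ Finset.range N, a k := Finset.sum_nonneg fun k _ => ha0 k
      have : 0 ≤ 2 * B * ∑ k ∈ Finset.range N, a k := by positivity
      linarith
    | succ n hn ih =>
      have h1 := hstep n hn (t (n + 1)) (ht0 _).le (ht n.le_succ) (by linarith)
      have h2 : backTaylor G s (n + 1) (t (n + 1)) = backTaylor G s n (t (n + 1)) +
          (-(t (n + 1) : ℂ)) ^ n / (n.factorial : ℂ) * G n (s + t (n + 1)) :=
        Finset.sum_range_succ _ _
      have h3 : ‖(-(t (n + 1) : ℂ)) ^ n / (n.factorial : ℂ) * G n (s + t (n + 1))‖ ≤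
          B * a n := by
        rw [norm_mul]
        have h4 := hbd n (n + 1) (s + t (n + 1)) (by linarith)
          (by linarith [htN (n + 1) (by omega)])
        calc _ ≤ t n ^ n * (B * m n * M (n + 1)) :=
              mul_le_mul ((norm_pow_div_factorial_le (ht0 _).le n).trans
                (pow_le_pow_left₀ (ht0 _).le (ht n.le_succ) n)) h4 (norm_nonneg _)
                (pow_nonneg (ht0 n).le n)
          _ = _ := by simp only [ha]; ring
      rw [Finset.sum_range_succ, h2]
      have h5 : backTaylor G s n (t (n + 1)) +
          (-(t (n + 1) : ℂ)) ^ n / (n.factorial : ℂ) * G n (s + t (n + 1)) =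
          (backTaylor G s n (t (n + 1)) - backTaylor G s n (t n)) +
          (-(t (n + 1) : ℂ)) ^ n / (n.factorial : ℂ) * G n (s + t (n + 1)) +
          backTaylor G s n (t n) := by ring
      rw [h5]
      refine (norm_add₃_le).trans ?_
      linarith
  -- Once the radius falls below `s`, the centre can move to `s` itself, where the polynomial is
  -- just `G 0 s`. The number of steps depends on `s`, but the bound does not.
  obtain ⟨n, hn, hns⟩ : ∃ n, N ≤ n ∧ t (n + 1) ≤ s := by
    obtain ⟨n, hn, h⟩ := ((eventually_ge_atTop N).and
      (htl.eventually (gt_mem_nhds hs0))).exists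
    exact ⟨n, hn, (ht n.le_succ).trans h.le⟩
  have h1 := hstep n hn 0 le_rfl (ht0 n).le (by linarith)
  rw [backTaylor_zero G s (by omega)] at h1
  have h2 := hJ n hn
  have h3 : ∑ k ∈ Finset.range n, a k ≤ ∑' n, a n := hs.sum_le_tsum _ fun k _ => ha0 k
  have h4 : a n ≤ ∑' n, a n := hs.le_tsum n fun k _ => ha0 k
  have h5 : ‖G 0 s‖ ≤ ‖G 0 s - backTaylor G s n (t n)‖ + ‖backTaylor G s n (t n)‖ := by
    simpa using norm_add_le (G 0 s - backTaylor G s n (t n)) (backTaylor G s n (t n))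
  nlinarith [mul_le_mul_of_nonneg_left h3 hB, mul_le_mul_of_nonneg_left h4 hB]

/-! ### Pairing an analytic function with test functions along horizontal slices -/

section Pairing

variable {d : ℕ} {U : Opens (EuclideanSpace ℝ (Fin d))} {Γ : Set (EuclideanSpace ℝ (Fin d))}
  {γ : ℝ} {F : EuclideanSpace ℂ (Fin d) → ℂ}

/-- The inclusion `ℝ^d → ℂ^d`. -/
def complexify (d : ℕ) : EuclideanSpace ℝ (Fin d) →L[ℝ] EuclideanSpace ℂ (Fin d) :=
  LinearMap.toContinuousLinearMap
    { toFun := fun x => WithLp.toLp 2 (fun j => (x j : ℂ))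
      map_add' := fun x y => by ext j; simp
      map_smul' := fun c x => by ext j; simp }

lemma complexify_apply (x : EuclideanSpace ℝ (Fin d)) (j : Fin d) :
    complexify d x j = (x j : ℂ) := rfl

/-- Multiplication by `i`, composed with the inclusion `ℝ^d → ℂ^d`. -/
def complexifyI (d : ℕ) : EuclideanSpace ℝ (Fin d) →L[ℝ] EuclideanSpace ℂ (Fin d) :=
  Complex.I • complexify d

lemma complexifyI_apply (x : EuclideanSpace ℝ (Fin d)) :
    complexifyI d x = Complex.I • complexify d x := rfl

lemma cpoint_eq (x y : EuclideanSpace ℝ (Fin d)) :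
    cpoint x y = complexify d x + complexifyI d y := by
  ext j
  simp [cpoint, complexify_apply, complexifyI_apply, mul_comm]

lemma continuous_cpoint :
    Continuous fun q : EuclideanSpace ℝ (Fin d) × EuclideanSpace ℝ (Fin d) => cpoint q.1 q.2 := by
  simp only [cpoint_eq]; fun_prop

lemma cpoint_mem_wedge {x y : EuclideanSpace ℝ (Fin d)} (hx : x ∈ U) (hy : y ∈ Γ)
    (hyγ : ‖y‖ < γ) : cpoint x y ∈ wedge U Γ γ := ⟨x, hx, y, hy, hyγ, rfl⟩

lemma continuousAt_slice {Y : Type*} [TopologicalSpace Y] {G : EuclideanSpace ℂ (Fin d) → Y}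
    (hG : ∀ z ∈ wedge U Γ γ, ContinuousAt G z) {x y : EuclideanSpace ℝ (Fin d)} (hx : x ∈ U)
    (hy : y ∈ Γ) (hyγ : ‖y‖ < γ) : ContinuousAt (fun x => G (cpoint x y)) x :=
  ContinuousAt.comp (f := fun x => cpoint x y) (g := G) (hG _ (cpoint_mem_wedge hx hy hyγ))
    (continuous_cpoint.comp (by fun_prop : Continuous fun x => (x, y))).continuousAt

lemma hasFDerivAt_slice_im (hF : AnalyticOnNhd ℂ F (wedge U Γ γ))
    {x y : EuclideanSpace ℝ (Fin d)} (hx : x ∈ U) (hy : y ∈ Γ) (hyγ : ‖y‖ < γ) :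
    HasFDerivAt (fun y => F (cpoint x y))
      (((fderiv ℂ F (cpoint x y)).restrictScalars ℝ).comp (complexifyI d)) y := by
  have h1 := ((hF _ (cpoint_mem_wedge hx hy hyγ)).differentiableAt.hasFDerivAt).restrictScalars ℝ
  refine h1.comp y (f := fun y => cpoint x y) ?_
  simp only [cpoint_eq]
  exact (complexifyI d).hasFDerivAt.const_add _

lemma hasFDerivAt_slice_re (hF : AnalyticOnNhd ℂ F (wedge U Γ γ))
    {x y : EuclideanSpace ℝ (Fin d)} (hx : x ∈ U) (hy : y ∈ Γ) (hyγ : ‖y‖ < γ) :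
    HasFDerivAt (fun x => F (cpoint x y))
      (((fderiv ℂ F (cpoint x y)).restrictScalars ℝ).comp (complexify d)) x := by
  have h1 := ((hF _ (cpoint_mem_wedge hx hy hyγ)).differentiableAt.hasFDerivAt).restrictScalars ℝ
  refine h1.comp x (f := fun x => cpoint x y) ?_
  simp only [cpoint_eq]
  exact (complexify d).hasFDerivAt.add_const _

lemma continuous_smul_of_tsupport_subset {X V : Type*} [TopologicalSpace X] [AddCommGroup V]
    [Module ℂ V] [TopologicalSpace V] [ContinuousSMul ℂ V] {s : Set X} {g : X → V} {ψ : X → ℂ}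
    (hg : ∀ x ∈ s, ContinuousAt g x) (hψ : Continuous ψ) (hs : tsupport ψ ⊆ s) :
    Continuous fun x => ψ x • g x := by
  refine continuous_of_tsupport fun x hx => ?_
  have hx' : x ∈ tsupport ψ :=
    closure_mono (fun z (hz : ψ z • g z ≠ 0) (hz' : ψ z = 0) => hz (by simp [hz'])) hx
  exact hψ.continuousAt.smul (hg x (hs hx'))

lemma integrable_smul_of_tsupport_subset {V : Type*} [NormedAddCommGroup V]
    [NormedSpace ℂ V] {g : EuclideanSpace ℝ (Fin d) → V}
    {ψ : EuclideanSpace ℝ (Fin d) → ℂ} (hg : ∀ x ∈ U, ContinuousAt g x) (hψ : Continuous ψ)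
    (hc : HasCompactSupport ψ) (hs : tsupport ψ ⊆ U) : Integrable fun x => ψ x • g x :=
  (continuous_smul_of_tsupport_subset hg hψ hs).integrable_of_hasCompactSupport hc.smul_right

/-- The pairing `∫ F (x + i y) ψ (x) dx`. -/
def pairing (F : EuclideanSpace ℂ (Fin d) → ℂ) (y : EuclideanSpace ℝ (Fin d))
    (ψ : EuclideanSpace ℝ (Fin d) → ℂ) : ℂ :=
  ∫ x, F (cpoint x y) * ψ x

lemma integrable_pairing (hF : AnalyticOnNhd ℂ F (wedge U Γ γ)) {y : EuclideanSpace ℝ (Fin d)}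
    (hy : y ∈ Γ) (hyγ : ‖y‖ < γ) {ψ : EuclideanSpace ℝ (Fin d) → ℂ} (hψ : Continuous ψ)
    (hc : HasCompactSupport ψ) (hs : tsupport ψ ⊆ U) :
    Integrable fun x => F (cpoint x y) * ψ x := by
  simpa only [smul_eq_mul, mul_comm] using integrable_smul_of_tsupport_subset
    (fun x hx => continuousAt_slice (fun z hz => (hF z hz).continuousAt) hx hy hyγ) hψ hc hs

lemma norm_pairing_le {K : Set (EuclideanSpace ℝ (Fin d))} (hK : IsCompact K)
    {y : EuclideanSpace ℝ (Fin d)} {ψ : EuclideanSpace ℝ (Fin d) → ℂ} (hs : tsupport ψ ⊆ K)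
    {a c : ℝ} (ha : ∀ x ∈ K, ‖F (cpoint x y)‖ ≤ a) (hc : ∀ x, ‖ψ x‖ ≤ c) :
    ‖pairing F y ψ‖ ≤ a * c * volume.real K := by
  have e : pairing F y ψ = ∫ x in K, F (cpoint x y) * ψ x := by
    refine (setIntegral_eq_integral_of_forall_compl_eq_zero fun x hx => ?_).symm
    rw [image_eq_zero_of_notMem_tsupport fun h => hx (hs h), mul_zero]
  rw [e]
  refine norm_setIntegral_le_of_norm_le_const hK.measure_lt_top fun x hx => ?_
  rw [norm_mul]
  exact mul_le_mul (ha x hx) (hc x) (norm_nonneg _) ((norm_nonneg _).trans (ha x hx))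

/-- The derivative of `ψ` in the direction `v`. -/
def dirDeriv (v : EuclideanSpace ℝ (Fin d)) (ψ : EuclideanSpace ℝ (Fin d) → ℂ)
    (x : EuclideanSpace ℝ (Fin d)) : ℂ :=
  fderiv ℝ ψ x v

/-- The pairing is differentiable in `y`; integrating by parts, the derivative falls on the test
function. -/
theorem hasFDerivAt_pairing (hΓ : IsOpen Γ) (hF : AnalyticOnNhd ℂ F (wedge U Γ γ))
    {y : EuclideanSpace ℝ (Fin d)} (hy : y ∈ Γ) (hyγ : ‖y‖ < γ)
    {ψ : EuclideanSpace ℝ (Fin d) → ℂ} (hψ : ContDiff ℝ 1 ψ) (hc : HasCompactSupport ψ)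
    (hs : tsupport ψ ⊆ U) :
    ∃ D : EuclideanSpace ℝ (Fin d) →L[ℝ] ℂ, HasFDerivAt (fun y => pairing F y ψ) D y ∧
      ∀ v, D v = -Complex.I * pairing F y (dirDeriv v ψ) := by
  have hopen : IsOpen (Γ ∩ Metric.ball 0 γ) := hΓ.inter Metric.isOpen_ball
  obtain ⟨δ, hδ, hball⟩ := Metric.nhds_basis_closedBall.mem_iff.1
    (hopen.mem_nhds ⟨hy, by simpa using hyγ⟩)
  have hball' : ∀ y' ∈ Metric.closedBall y δ, y' ∈ Γ ∧ ‖y'‖ < γ := fun y' h =>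
    ⟨(hball h).1, by simpa using (hball h).2⟩
  have hdc : ∀ z ∈ wedge U Γ γ, ContinuousAt (fderiv ℂ F) z := fun z hz =>
    (hF z hz).fderiv.continuousAt
  set L : EuclideanSpace ℝ (Fin d) → EuclideanSpace ℝ (Fin d) →
      EuclideanSpace ℝ (Fin d) →L[ℝ] ℂ := fun y x =>
    ((fderiv ℂ F (cpoint x y)).restrictScalars ℝ).comp (complexifyI d) with hL
  have hLc : ∀ x ∈ U, ContinuousAt (L y) x := fun x hx => by
    have h1 := continuousAt_slice hdc hx hy hyγ
    have h2 := (ContinuousLinearMap.continuous_restrictScalars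
      (𝕜 := ℂ) (E := EuclideanSpace ℂ (Fin d)) (F := ℂ) ℝ).continuousAt.comp h1
    exact h2.clm_comp continuousAt_const
  have hK : IsCompact (tsupport ψ ×ˢ Metric.closedBall y δ) :=
    hc.isCompact.prod (isCompact_closedBall y δ)
  obtain ⟨C, hC⟩ := hK.exists_bound_of_continuousOn (f := fun q => fderiv ℂ F (cpoint q.1 q.2))
    (fun q hq => (ContinuousAt.comp (f := fun q : _ × _ => cpoint q.1 q.2) (g := fderiv ℂ F)
      (hdc _ (cpoint_mem_wedge (hs hq.1) (hball' _ hq.2).1 (hball' _ hq.2).2))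
      continuous_cpoint.continuousAt).continuousWithinAt)
  have hLb : ∀ x ∈ tsupport ψ, ∀ y' ∈ Metric.closedBall y δ,
      ‖L y' x‖ ≤ C * ‖complexifyI d‖ := fun x hx y' hy' => by
    refine (ContinuousLinearMap.opNorm_comp_le _ _).trans ?_
    rw [ContinuousLinearMap.norm_restrictScalars]
    exact mul_le_mul_of_nonneg_right (hC (x, y') ⟨hx, hy'⟩) (norm_nonneg _)
  have hψ0 : ∀ x, x ∉ tsupport ψ → ψ x = 0 := fun x hx => image_eq_zero_of_notMem_tsupport hx
  have hint : Integrable fun x => ψ x • L y x :=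
    integrable_smul_of_tsupport_subset hLc hψ.continuous hc hs
  -- Differentiation under the integral; the domination comes from compactness of the support times
  -- a closed ball of admissible `y`.
  have key := hasFDerivAt_integral_of_dominated_of_fderiv_le (𝕜 := ℝ) (μ := volume)
    (F := fun y x => F (cpoint x y) * ψ x) (F' := fun y x => ψ x • L y x)
    (bound := fun x => C * ‖complexifyI d‖ * ‖ψ x‖) (x₀ := y)
    (Metric.closedBall_mem_nhds y hδ)
    (by
      filter_upwards [Metric.closedBall_mem_nhds y hδ] with y' hy'
      exact (integrable_pairing hF (hball' _ hy').1 (hball' _ hy').2 hψ.continuous hc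
        hs).aestronglyMeasurable)
    (integrable_pairing hF hy hyγ hψ.continuous hc hs)
    hint.aestronglyMeasurable
    (Eventually.of_forall fun x y' hy' => by
      by_cases hx : x ∈ tsupport ψ
      · rw [norm_smul, mul_comm]
        exact mul_le_mul_of_nonneg_right (hLb x hx y' hy') (norm_nonneg _)
      · simp [hψ0 x hx])
    ((hψ.continuous.norm.integrable_of_hasCompactSupport hc.norm).const_mul _)
    (Eventually.of_forall fun x y' hy' => by
      by_cases hx : x ∈ tsupport ψ
      · exact (hasFDerivAt_slice_im hF (hs hx) (hball' _ hy').1 (hball' _ hy').2).mul_const (ψ x)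
      · simp only [hψ0 x hx, mul_zero]
        exact (hasFDerivAt_const (𝕜 := ℝ) (0 : ℂ) y').congr_fderiv (zero_smul ℂ (L y' x)).symm)
  refine ⟨_, key, fun v => ?_⟩
  rw [ContinuousLinearMap.integral_apply hint]
  have hslice : ∀ x ∈ tsupport ψ, fderiv ℝ (fun x => F (cpoint x y)) x v =
      fderiv ℂ F (cpoint x y) (complexify d v) := fun x hx => by
    rw [(hasFDerivAt_slice_re hF (hs hx) hy hyγ).fderiv]; rfl
  -- Cauchy–Riemann: the derivative of `F` in an imaginary direction is `i` times the one in the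
  -- corresponding real direction, which can be integrated by parts in `x`.
  have e1 : ∀ x, (ψ x • L y x) v =
      Complex.I * (ψ x * fderiv ℝ (fun x => F (cpoint x y)) x v) := fun x => by
    by_cases hx : x ∈ tsupport ψ
    · rw [hslice x hx]
      simp only [hL, _root_.smul_apply, ContinuousLinearMap.comp_apply,
        ContinuousLinearMap.coe_restrictScalars', complexifyI_apply, map_smul, smul_eq_mul]
      ring
    · simp [hψ0 x hx]
  have hdψ : Continuous (dirDeriv v ψ) :=
    (hψ.continuous_fderiv one_ne_zero).clm_apply continuous_const
  have hdc' : HasCompactSupport (dirDeriv v ψ) := hc.fderiv_apply ℝ v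
  have hds : tsupport (dirDeriv v ψ) ⊆ U := (tsupport_fderiv_apply_subset ℝ v).trans hs
  simp_rw [e1]
  rw [integral_const_mul, integral_mul_fderiv_eq_neg_fderiv_mul_of_integrable]
  · rw [pairing, mul_neg, neg_mul]
    simp only [dirDeriv, mul_comm]
  · simpa only [mul_comm, dirDeriv] using integrable_pairing hF hy hyγ hdψ hdc' hds
  · have h := integrable_smul_of_tsupport_subset (U := U)
      (g := fun x => fderiv ℂ F (cpoint x y) (complexify d v))
      (fun x hx => (continuousAt_slice hdc hx hy hyγ).clm_apply continuousAt_const)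
      hψ.continuous hc hs
    refine h.congr (Eventually.of_forall fun x => ?_)
    by_cases hx : x ∈ tsupport ψ
    · simp only [hslice x hx, smul_eq_mul]
    · simp [hψ0 x hx]
  · simpa only [mul_comm] using integrable_pairing hF hy hyγ hψ.continuous hc hs
  · exact fun x _ => (hψ.differentiable one_ne_zero).differentiableAt
  · exact fun x hx => (hasFDerivAt_slice_re hF (hs hx) hy hyγ).differentiableAt

/-! ### Iterated directional derivatives of test functions -/

lemma contDiff_dirDeriv (v : EuclideanSpace ℝ (Fin d)) {ψ : EuclideanSpace ℝ (Fin d) → ℂ}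
    (hψ : ContDiff ℝ (⊤ : ℕ∞) ψ) : ContDiff ℝ (⊤ : ℕ∞) (dirDeriv v ψ) :=
  (hψ.fderiv_right (m := (⊤ : ℕ∞)) (by exact_mod_cast le_top)).clm_apply contDiff_const

lemma tsupport_dirDeriv_subset (v : EuclideanSpace ℝ (Fin d))
    (ψ : EuclideanSpace ℝ (Fin d) → ℂ) : tsupport (dirDeriv v ψ) ⊆ tsupport ψ :=
  tsupport_fderiv_apply_subset ℝ v

lemma norm_iteratedFDeriv_dirDeriv_le (v : EuclideanSpace ℝ (Fin d))
    {ψ : EuclideanSpace ℝ (Fin d) → ℂ} (hψ : ContDiff ℝ (⊤ : ℕ∞) ψ) (n : ℕ)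
    (x : EuclideanSpace ℝ (Fin d)) :
    ‖iteratedFDeriv ℝ n (dirDeriv v ψ) x‖ ≤ ‖v‖ * ‖iteratedFDeriv ℝ (n + 1) ψ x‖ := by
  rw [← norm_iteratedFDeriv_fderiv]
  exact norm_iteratedFDeriv_clm_apply_const (N := (⊤ : ℕ∞))
    (hψ.fderiv_right (m := (⊤ : ℕ∞)) (by exact_mod_cast le_top)).contDiffAt
    (by exact_mod_cast le_top)

lemma contDiff_iterate_dirDeriv (v : EuclideanSpace ℝ (Fin d))
    {ψ : EuclideanSpace ℝ (Fin d) → ℂ} (hψ : ContDiff ℝ (⊤ : ℕ∞) ψ) (k : ℕ) :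
    ContDiff ℝ (⊤ : ℕ∞) ((dirDeriv v)^[k] ψ) := by
  induction k with
  | zero => exact hψ
  | succ k ih => rw [Function.iterate_succ_apply']; exact contDiff_dirDeriv v ih

lemma tsupport_iterate_dirDeriv_subset (v : EuclideanSpace ℝ (Fin d))
    (ψ : EuclideanSpace ℝ (Fin d) → ℂ) (k : ℕ) :
    tsupport ((dirDeriv v)^[k] ψ) ⊆ tsupport ψ := by
  induction k with
  | zero => exact subset_rfl
  | succ k ih =>
    rw [Function.iterate_succ_apply']
    exact (tsupport_dirDeriv_subset v _).trans ih

lemma norm_iteratedFDeriv_iterate_dirDeriv_le {v : EuclideanSpace ℝ (Fin d)} (hv : ‖v‖ ≤ 1)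
    {ψ : EuclideanSpace ℝ (Fin d) → ℂ} (hψ : ContDiff ℝ (⊤ : ℕ∞) ψ) (k n : ℕ)
    (x : EuclideanSpace ℝ (Fin d)) :
    ‖iteratedFDeriv ℝ n ((dirDeriv v)^[k] ψ) x‖ ≤ ‖iteratedFDeriv ℝ (n + k) ψ x‖ := by
  induction k generalizing n with
  | zero => exact le_rfl
  | succ k ih =>
    rw [Function.iterate_succ_apply']
    refine (norm_iteratedFDeriv_dirDeriv_le v (contDiff_iterate_dirDeriv v hψ k) n x).trans ?_
    refine (mul_le_of_le_one_left (norm_nonneg _) hv).trans ((ih (n + 1)).trans_eq ?_)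
    rw [add_right_comm, add_assoc]

lemma norm_iterate_dirDeriv_le {v : EuclideanSpace ℝ (Fin d)} (hv : ‖v‖ ≤ 1)
    {ψ : EuclideanSpace ℝ (Fin d) → ℂ} (hψ : ContDiff ℝ (⊤ : ℕ∞) ψ) (k : ℕ)
    (x : EuclideanSpace ℝ (Fin d)) :
    ‖(dirDeriv v)^[k] ψ x‖ ≤ ‖iteratedFDeriv ℝ k ψ x‖ := by
  have := norm_iteratedFDeriv_iterate_dirDeriv_le hv hψ k 0 x
  rwa [norm_iteratedFDeriv_zero, zero_add] at this

/-- The slices of `F` near the edge act equicontinuously on test functions whose derivatives are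
controlled by a sequence `m` that the growth of `F` allows. -/
theorem norm_pairing_le_of_growth (hΓ : IsOpen Γ) (hcone : ∀ y ∈ Γ, ∀ t : ℝ, 0 < t → t • y ∈ Γ)
    (hF : AnalyticOnNhd ℂ F (wedge U Γ γ)) {σ b r A : ℝ} (hσ : 1 < σ) (hb : 0 < b) {m : ℕ → ℝ}
    (hm : ∀ n, 0 ≤ m n) (hsum : Summable fun n => m n * radius σ b n ^ n * growth σ b (n + 1))
    (hr : 0 < r) (hrγ : r ≤ γ)
    (hA : ∀ n, ∀ x ∈ U, ∀ y ∈ Γ, radius σ b n ≤ ‖y‖ → ‖y‖ < r →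
      ‖F (cpoint x y)‖ ≤ A * growth σ b n) (hA0 : 0 ≤ A)
    {K : Set (EuclideanSpace ℝ (Fin d))} (hK : IsCompact K) (hKU : K ⊆ U) :
    ∃ C, 0 ≤ C ∧ ∀ (ψ : EuclideanSpace ℝ (Fin d) → ℂ) (B : ℝ), ContDiff ℝ (⊤ : ℕ∞) ψ →
      tsupport ψ ⊆ K → 0 ≤ B → (∀ n x, ‖iteratedFDeriv ℝ n ψ x‖ ≤ B * m n) →
      ∀ y ∈ Γ, y ≠ 0 → ‖y‖ < r / 2 → ‖pairing F y ψ‖ ≤ C * B := by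
  -- The one-variable constant is fixed before `ψ` and `y`, so it is uniform over all rays of the
  -- cone.
  obtain ⟨C, hC0, hC⟩ := norm_le_of_derivatives_growth (radius_anti hσ hb) (radius_pos σ b)
    (radius_le_one hσ hb) (tendsto_radius hσ hb) (growth_nonneg σ b) hm hsum hr
  have hV : 0 ≤ volume.real K := measureReal_nonneg
  refine ⟨C * (A * volume.real K), by positivity, fun ψ B hψ hs hB hbd y hy hy0 hyr => ?_⟩
  have hn : 0 < ‖y‖ := norm_pos_iff.2 hy0
  set w : EuclideanSpace ℝ (Fin d) := ‖y‖⁻¹ • y with hw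
  have hw1 : ‖w‖ = 1 := by rw [hw, norm_smul, norm_inv, norm_norm, inv_mul_cancel₀ hn.ne']
  have hwΓ : ∀ s : ℝ, 0 < s → s • w ∈ Γ := fun s hs => by
    rw [hw, smul_smul]; exact hcone y hy _ (by positivity)
  have hws : ∀ s : ℝ, 0 < s → ‖s • w‖ = s := fun s hs => by
    rw [norm_smul, hw1, mul_one, Real.norm_of_nonneg hs.le]
  have hsk : ∀ k, tsupport ((dirDeriv w)^[k] ψ) ⊆ K := fun k =>
    (tsupport_iterate_dirDeriv_subset w ψ k).trans hs
  -- The powers of `-i` from `hasFDerivAt_pairing` are built in, so that each member of the sequence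
  -- is exactly the derivative of the preceding one.
  have hgoal := hC (fun k s => (-Complex.I) ^ k * pairing F (s • w) ((dirDeriv w)^[k] ψ))
    (A * volume.real K * B) (by positivity) ?_ ?_ ‖y‖ hn hyr
  · have e : ‖y‖ • w = y := by rw [hw, smul_smul, mul_inv_cancel₀ hn.ne', one_smul]
    simp only [pow_zero, one_mul, Function.iterate_zero, id_eq, e] at hgoal
    exact hgoal.trans_eq (by ring)
  · intro k s hs0 hsr
    obtain ⟨D, hD, hDv⟩ := hasFDerivAt_pairing hΓ hF (hwΓ s hs0)
      (by rw [hws s hs0]; linarith)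
      ((contDiff_iterate_dirDeriv w hψ k).of_le (by exact_mod_cast le_top))
      (hK.of_isClosed_subset (isClosed_tsupport _) (hsk k)) ((hsk k).trans hKU)
    have h1 : HasDerivAt (fun s : ℝ => s • w) w s := by
      simpa using (hasDerivAt_id s).smul_const w
    have h2 := (hD.comp_hasDerivAt s h1).const_mul ((-Complex.I) ^ k)
    refine h2.congr_deriv ?_
    rw [hDv, Function.iterate_succ_apply', pow_succ, mul_assoc]
  · intro k n s hns hsr
    have hs0 : 0 < s := (radius_pos σ b n).trans_le hns
    rw [norm_mul, norm_pow, norm_neg, Complex.norm_I, one_pow, one_mul]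
    refine (norm_pairing_le hK (hsk k) (fun x hx => hA n x (hKU hx) _ (hwΓ s hs0)
      (by rwa [hws s hs0]) (by rwa [hws s hs0]))
      (fun x => (norm_iterate_dirDeriv_le hw1.le hψ k x).trans (hbd k x))).trans_eq ?_
    ring

end Pairing

/-! ### Limits along a cone of functions with bounded derivative -/

lemma norm_sub_le_of_segment {V : Type*} [NormedAddCommGroup V] [NormedSpace ℝ V] {Γ : Set V}
    {g : V → ℂ} {ρ C : ℝ}
    (hg : ∀ y ∈ Γ, y ≠ 0 → ‖y‖ < ρ → ∃ D : V →L[ℝ] ℂ, HasFDerivAt g D y ∧ ‖D‖ ≤ C)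
    {s : Set V} (hs : Convex ℝ s) (hsΓ : s ⊆ Γ) (hs0 : (0 : V) ∉ s) (hsρ : ∀ z ∈ s, ‖z‖ < ρ)
    {x y : V} (hx : x ∈ s) (hy : y ∈ s) : ‖g y - g x‖ ≤ C * ‖y - x‖ := by
  choose! D hD using hg
  have h := fun z hz => hD z (hsΓ hz) (fun e => hs0 (e ▸ hz)) (hsρ z hz)
  exact hs.norm_image_sub_le_of_norm_hasFDerivWithin_le
    (fun z hz => (h z hz).1.hasFDerivWithinAt) (fun z hz => (h z hz).2) hx hy

lemma convex_openRay {V : Type*} [AddCommGroup V] [Module ℝ V] (y : V) (a : ℝ) :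
    Convex ℝ ((fun t : ℝ => t • y) '' Set.Ioc 0 a) :=
  (convex_Ioc 0 a).is_linear_image (LinearMap.toSpanSingleton ℝ V y).isLinear

lemma norm_sub_le_of_ray {V : Type*} [NormedAddCommGroup V] [NormedSpace ℝ V] {Γ : Set V}
    (hcone : ∀ y ∈ Γ, ∀ t : ℝ, 0 < t → t • y ∈ Γ) {g : V → ℂ} {ρ C : ℝ}
    (hg : ∀ y ∈ Γ, y ≠ 0 → ‖y‖ < ρ → ∃ D : V →L[ℝ] ℂ, HasFDerivAt g D y ∧ ‖D‖ ≤ C)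
    {y : V} (hy : y ∈ Γ) (hy0 : y ≠ 0) {t s : ℝ} (ht : 0 < t) (hs : 0 < s)
    (htρ : t * ‖y‖ < ρ) (hsρ : s * ‖y‖ < ρ) :
    ‖g (s • y) - g (t • y)‖ ≤ C * (|s - t| * ‖y‖) := by
  have := norm_sub_le_of_segment hg (convex_openRay y (max t s)) (x := t • y) (y := s • y)
    (by rintro _ ⟨v, hv, rfl⟩; exact hcone y hy v hv.1)
    (by rintro ⟨v, hv, h⟩; exact (smul_ne_zero hv.1.ne' hy0) h)
    (by
      rintro _ ⟨v, hv, rfl⟩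
      simp only [norm_smul, Real.norm_of_nonneg hv.1.le]
      rcases le_total t s with h | h
      · rw [max_eq_right h] at hv
        exact (mul_le_mul_of_nonneg_right hv.2 (norm_nonneg y)).trans_lt hsρ
      · rw [max_eq_left h] at hv
        exact (mul_le_mul_of_nonneg_right hv.2 (norm_nonneg y)).trans_lt htρ)
    ⟨t, ⟨ht, le_max_left _ _⟩, rfl⟩ ⟨s, ⟨hs, le_max_right _ _⟩, rfl⟩
  rwa [← sub_smul, norm_smul, Real.norm_eq_abs] at this

lemma eventually_mul_lt {a ρ : ℝ} (hρ : 0 < ρ) : ∀ᶠ s in 𝓝[>] (0 : ℝ), 0 < s ∧ s * a < ρ := by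
  have h1 : Tendsto (fun s : ℝ => s * a) (𝓝[>] 0) (𝓝 (0 * a)) :=
    (tendsto_id.mul_const a).mono_left nhdsWithin_le_nhds
  rw [zero_mul] at h1
  exact (eventually_mem_nhdsWithin (a := (0 : ℝ)) (s := Set.Ioi 0)).and
    (h1.eventually (gt_mem_nhds hρ))

/-- A function with bounded derivative on a connected open cone, truncated to a ball, has a limit
at the apex. The rate does not depend on the geometry of the cone. -/
theorem exists_limit_at_apex {V : Type*} [NormedAddCommGroup V] [NormedSpace ℝ V] {Γ : Set V}
    (hΓ : IsOpen Γ) (hcone : ∀ y ∈ Γ, ∀ t : ℝ, 0 < t → t • y ∈ Γ) (hconn : IsPreconnected Γ)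
    {g : V → ℂ} {ρ C : ℝ} (hρ : 0 < ρ)
    (hg : ∀ y ∈ Γ, y ≠ 0 → ‖y‖ < ρ → ∃ D : V →L[ℝ] ℂ, HasFDerivAt g D y ∧ ‖D‖ ≤ C)
    (hg0 : (0 : V) ∈ Γ → ContinuousAt g 0) :
    ∃ u : ℂ, ∀ y ∈ Γ, ‖y‖ < ρ → ‖g y - u‖ ≤ C * ‖y‖ := by
  by_cases h0 : (0 : V) ∈ Γ
  -- If the apex lies in the cone, no derivative bound is given there; continuity at `0` replaces
  -- it.
  · refine ⟨g 0, fun y hy hyρ => ?_⟩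
    rcases eq_or_ne y 0 with rfl | hy0
    · simp
    have h1 : Tendsto (fun s : ℝ => s • y) (𝓝[>] 0) (𝓝 ((0 : ℝ) • y)) :=
      (tendsto_id.smul_const y).mono_left nhdsWithin_le_nhds
    rw [zero_smul] at h1
    have h2 : Tendsto (fun s : ℝ => ‖g y - g (s • y)‖) (𝓝[>] 0) (𝓝 ‖g y - g 0‖) :=
      (tendsto_const_nhds.sub ((hg0 h0).tendsto.comp h1)).norm
    have h3 : Tendsto (fun s : ℝ => C * (|1 - s| * ‖y‖)) (𝓝[>] 0) (𝓝 (C * (|1 - 0| * ‖y‖))) :=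
      Tendsto.mono_left (Continuous.tendsto (by fun_prop) 0) nhdsWithin_le_nhds
    rw [sub_zero, abs_one, one_mul] at h3
    refine le_of_tendsto_of_tendsto h2 h3 ?_
    filter_upwards [eventually_mul_lt (a := ‖y‖) hρ] with s hs
    simpa using norm_sub_le_of_ray hcone hg hy hy0 hs.1 one_pos hs.2 (by rwa [one_mul])
  have hne : ∀ y ∈ Γ, y ≠ 0 := fun y hy e => h0 (e ▸ hy)
  rcases Γ.eq_empty_or_nonempty with rfl | ⟨y₁, hy₁⟩
  · exact ⟨0, fun y hy => absurd hy (Set.notMem_empty y)⟩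
  -- Along each ray `g` is Lipschitz, hence Cauchy at the apex.
  have hlim : ∀ y ∈ Γ, ∃ u, Tendsto (fun s : ℝ => g (s • y)) (𝓝[>] 0) (𝓝 u) := fun y hy => by
    refine cauchy_map_iff_exists_tendsto.1 (Metric.cauchy_iff.2 ⟨inferInstance, fun ε hε => ?_⟩)
    have hC : 0 < |C| + 1 := by positivity
    refine ⟨_, image_mem_map ((eventually_mul_lt (a := ‖y‖) hρ).and
      (eventually_mul_lt (a := ‖y‖) (ρ := ε / (|C| + 1)) (by positivity))), ?_⟩
    rintro _ ⟨s, ⟨⟨hs, hsρ⟩, -, hsε⟩, rfl⟩ _ ⟨t, ⟨⟨ht, htρ⟩, -, htε⟩, rfl⟩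
    rw [dist_eq_norm]
    refine (norm_sub_le_of_ray hcone hg hy (hne y hy) ht hs htρ hsρ).trans_lt ?_
    have h1 : |s - t| * ‖y‖ < ε / (|C| + 1) := by
      rcases abs_cases (s - t) with ⟨h, -⟩ | ⟨h, -⟩ <;> rw [h] <;>
        nlinarith [mul_nonneg hs.le (norm_nonneg y), mul_nonneg ht.le (norm_nonneg y)]
    have h2 : 0 ≤ |s - t| * ‖y‖ := by positivity
    rw [lt_div_iff₀ hC] at h1
    nlinarith [le_abs_self C]
  choose! u hu using hlim
  -- A ball around `y` inside the cone, scaled by `s`, stays in the cone and is convex. So `g`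
  -- differs by at most `C s |y' - y|` at `s y` and `s y'`, the radial limit is locally constant,
  -- and connectedness makes it constant.
  have hloc : ∀ y ∈ Γ, ∀ y' ∈ Γ, u y = u y' := by
    intro a ha a' ha'
    refine hconn.induction₂ (fun y y' => u y = u y') ?_ (fun _ _ _ _ _ _ h h' => h.trans h')
      (fun _ _ _ _ h => h.symm) ha ha'
    intro y hy
    obtain ⟨δ, hδ, hball⟩ := Metric.isOpen_iff.1 hΓ y hy
    filter_upwards [mem_nhdsWithin_of_mem_nhds (Metric.ball_mem_nhds y hδ)] with y' hy'
    have h1 : Tendsto (fun s : ℝ => ‖g (s • y') - g (s • y)‖) (𝓝[>] 0) (𝓝 ‖u y' - u y‖) :=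
      ((hu y' (hball hy')).sub (hu y hy)).norm
    have h2 : Tendsto (fun s : ℝ => C * (s * ‖y' - y‖)) (𝓝[>] 0) (𝓝 (C * (0 * ‖y' - y‖))) :=
      Tendsto.mono_left (Continuous.tendsto (by fun_prop) 0) nhdsWithin_le_nhds
    rw [zero_mul, mul_zero] at h2
    have h3 : ‖u y' - u y‖ ≤ 0 := by
      refine le_of_tendsto_of_tendsto h1 h2 ?_
      filter_upwards [eventually_mul_lt (a := ‖y‖ + δ) hρ] with s hs
      have himg : Convex ℝ ((fun z : V => s • z) '' Metric.ball y δ) :=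
        (convex_ball y δ).is_linear_image (LinearMap.lsmul ℝ V s).isLinear
      have := norm_sub_le_of_segment hg himg (x := s • y) (y := s • y')
        (by rintro _ ⟨z, hz, rfl⟩; exact hcone z (hball hz) s hs.1)
        (by rintro ⟨z, hz, h⟩; exact smul_ne_zero hs.1.ne' (hne z (hball hz)) h)
        (by
          rintro _ ⟨z, hz, rfl⟩
          simp only [norm_smul, Real.norm_of_nonneg hs.1.le]
          refine lt_of_le_of_lt (mul_le_mul_of_nonneg_left ?_ hs.1.le) hs.2
          have h4 : ‖z‖ ≤ ‖y‖ + ‖z - y‖ := by simpa using norm_add_le y (z - y)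
          rw [Metric.mem_ball, dist_eq_norm] at hz
          linarith)
        ⟨y, Metric.mem_ball_self hδ, rfl⟩ ⟨y', hy', rfl⟩
      rwa [← smul_sub, norm_smul, Real.norm_of_nonneg hs.1.le] at this
    exact (sub_eq_zero.1 (norm_le_zero_iff.1 h3)).symm
  refine ⟨u y₁, fun y hy hyρ => ?_⟩
  rw [hloc y₁ hy₁ y hy]
  have h2 : Tendsto (fun s : ℝ => ‖g y - g (s • y)‖) (𝓝[>] 0) (𝓝 ‖g y - u y‖) :=
    (tendsto_const_nhds.sub (hu y hy)).norm
  have h3 : Tendsto (fun s : ℝ => C * (|1 - s| * ‖y‖)) (𝓝[>] 0) (𝓝 (C * (|1 - 0| * ‖y‖))) :=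
    Tendsto.mono_left (Continuous.tendsto (by fun_prop) 0) nhdsWithin_le_nhds
  rw [sub_zero, abs_one, one_mul] at h3
  refine le_of_tendsto_of_tendsto h2 h3 ?_
  filter_upwards [eventually_mul_lt (a := ‖y‖) hρ] with s hs
  simpa using norm_sub_le_of_ray hcone hg hy (hne y hy) hs.1 one_pos hs.2 (by rwa [one_mul])

/-! ### Topological preliminaries -/

lemma isTopologicalAddGroup_seminormTopology {V : Type*} [AddCommGroup V] [Module ℂ V]
    (P : Set (Seminorm ℂ V)) : @IsTopologicalAddGroup V (seminormTopology P) _ := by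
  refine topologicalAddGroup_iInf fun p => topologicalAddGroup_iInf fun _ => ?_
  let := p.toSeminormedAddCommGroup
  exact inferInstanceAs (IsTopologicalAddGroup V)

lemma continuous_of_mem_seminormTopology {V : Type*} [AddCommGroup V] [Module ℂ V]
    {P : Set (Seminorm ℂ V)} {p : Seminorm ℂ V} (hp : p ∈ P) :
    @Continuous V ℝ (seminormTopology P) _ p := by
  refine continuous_iInf_dom (i := p) (continuous_iInf_dom (i := hp) ?_)
  let := p.toSeminormedAddCommGroup
  exact continuous_norm (E := V)

section Criteria

variable {X : Type*} [AddCommGroup X] [Module ℂ X] [TopologicalSpace X]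

lemma continuous_of_norm_le_seminorm [IsTopologicalAddGroup X] {p : Seminorm ℂ X}
    (hp : Continuous p) {f : X →ₗ[ℂ] ℂ} (hf : ∀ φ, ‖f φ‖ ≤ p φ) : Continuous f := by
  refine continuous_of_continuousAt_zero f ?_
  have h1 : Tendsto p (𝓝 0) (𝓝 0) := by simpa using hp.tendsto 0
  simpa [ContinuousAt] using squeeze_zero_norm hf h1

/-- A bounded set is absorbed by the open unit ball of a continuous seminorm. -/
lemma exists_bound_of_isVonNBounded {p : Seminorm ℂ X} (hp : Continuous p) {s : Set X}
    (hs : Bornology.IsVonNBounded ℂ s) : ∃ C, 0 < C ∧ ∀ φ ∈ s, p φ ≤ C := by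
  have hV : {φ | p φ < 1} ∈ 𝓝 (0 : X) :=
    (isOpen_lt hp continuous_const).mem_nhds (by simp)
  obtain ⟨r, hr0, hr⟩ := (hs hV).exists_pos
  refine ⟨r, hr0, fun φ hφ => ?_⟩
  obtain ⟨ψ, hψ, rfl⟩ := hr (r : ℂ) (by simp [abs_of_pos hr0]) hφ
  have hψ' : p ψ < 1 := hψ
  simp only [map_smul_eq_mul, Complex.norm_real, Real.norm_of_nonneg hr0.le]
  nlinarith

/-- Convergence in the strong dual follows from a rate relative to a continuous seminorm. -/
lemma tendsto_strongDual {ι : Type*} {l : Filter ι} {f : ι → X →L[ℂ] ℂ} {u : X →L[ℂ] ℂ}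
    {ε : ι → ℝ} (hε : Tendsto ε l (𝓝 0)) {p : Seminorm ℂ X} (hp : Continuous p)
    (h : ∀ᶠ i in l, ∀ φ, ‖f i φ - u φ‖ ≤ ε i * p φ) : Tendsto f l (𝓝 u) := by
  refine (UniformConvergenceCLM.tendsto_iff_tendstoUniformlyOn (F := ℂ) (σ := RingHom.id ℂ)
    {s : Set X | Bornology.IsVonNBounded ℂ s}).2 fun s hs => ?_
  obtain ⟨C, hC0, hC⟩ := exists_bound_of_isVonNBounded hp hs
  refine Metric.tendstoUniformlyOn_iff.2 fun δ hδ => ?_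
  have h1 : Tendsto (fun i => |ε i| * C) l (𝓝 0) := by
    simpa using hε.abs.mul_const C
  filter_upwards [h, h1.eventually (gt_mem_nhds hδ)] with i hi hiδ φ hφ
  rw [dist_comm, dist_eq_norm]
  refine (hi φ).trans_lt (lt_of_le_of_lt ?_ hiδ)
  have h2 : 0 ≤ p φ := apply_nonneg p φ
  exact mul_le_mul (le_abs_self _) (hC φ hφ) h2 (abs_nonneg _)

end Criteria

/-! ### Boundary values under an abstract growth condition -/

section BoundaryValue

variable {d : ℕ} {U : Opens (EuclideanSpace ℝ (Fin d))} {Γ : Set (EuclideanSpace ℝ (Fin d))}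
  {γ : ℝ} {F : EuclideanSpace ℂ (Fin d) → ℂ}

lemma norm_apply_le_of_basis {n : ℕ}
    (f : ContinuousMultilinearMap ℝ (fun _ : Fin n => EuclideanSpace ℝ (Fin d)) ℂ) {c : ℝ}
    (hc : 0 ≤ c)
    (h : ∀ s : Fin n → Fin d, ‖f fun i => EuclideanSpace.single (s i) (1 : ℝ)‖ ≤ c) :
    ‖f‖ ≤ (d : ℝ) ^ n * c := by
  refine f.opNorm_le_bound (by positivity) fun v => ?_
  have hv : v = fun i => ∑ k, v i k • EuclideanSpace.single k (1 : ℝ) := by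
    funext i
    ext k
    simp [Finset.sum_apply, Pi.single_apply]
  have e : f v = ∑ s : Fin n → Fin d,
      (∏ i, v i (s i)) • f fun i => EuclideanSpace.single (s i) (1 : ℝ) := by
    conv_lhs => rw [hv]
    rw [f.map_sum]
    exact Finset.sum_congr rfl fun s _ => f.map_smul_univ _ _
  rw [e]
  refine (norm_sum_le_of_le (f := fun s : Fin n → Fin d =>
    (∏ i, v i (s i)) • f fun i => EuclideanSpace.single (s i) (1 : ℝ)) _
    (n := fun _ => (∏ i, ‖v i‖) * c) fun s _ => ?_).trans_eq ?_
  · rw [norm_smul, norm_prod]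
    refine mul_le_mul (Finset.prod_le_prod (fun _ _ => norm_nonneg _) fun i _ => ?_) (h s)
      (norm_nonneg _) (Finset.prod_nonneg fun _ _ => norm_nonneg _)
    exact PiLp.norm_apply_le (v i) (s i)
  · simp
    ring

/-- Passing from partial derivatives to the operator norm costs `d ^ n`. It is enlarged to `(d + 1)
^ n` so that the base is positive also for `d = 0`, as `summable_weight` requires. -/
lemma norm_iteratedFDeriv_le_ultraNorm {τ σ h : ℝ} (hσ : 1 < σ) (hh : 0 < h) {φ : 𝓓(U, ℂ)}
    (hφ : ultraNorm τ σ h φ < ∞) (n : ℕ) (x : EuclideanSpace ℝ (Fin d)) :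
    ‖iteratedFDeriv ℝ n φ x‖ ≤
      (ultraNorm τ σ h φ).toReal * (((d : ℝ) + 1) ^ n * weight τ σ h n) := by
  have hw := weight_pos (τ := τ) hσ hh n
  have h1 := norm_apply_le_of_basis (iteratedFDeriv ℝ n φ x)
    (c := (ultraNorm τ σ h φ).toReal * weight τ σ h n) (by positivity) fun s => by
      have := (ENNReal.ofReal_le_iff_le_toReal hφ.ne).1 (le_ultraNorm τ σ h φ s x)
      rwa [div_le_iff₀ hw] at this
  refine h1.trans ?_
  have h2 : (d : ℝ) ^ n ≤ ((d : ℝ) + 1) ^ n := pow_le_pow_left₀ (by positivity) (by linarith) n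
  calc _ ≤ ((d : ℝ) + 1) ^ n * ((ultraNorm τ σ h φ).toReal * weight τ σ h n) := by gcongr
    _ = _ := by ring

lemma norm_le_ultraNorm {τ σ h : ℝ} (hσ : 1 < σ) (hh : 0 < h) {φ : 𝓓(U, ℂ)}
    (hφ : ultraNorm τ σ h φ < ∞) (x : EuclideanSpace ℝ (Fin d)) :
    ‖φ x‖ ≤ (ultraNorm τ σ h φ).toReal := by
  simpa [weight_zero hσ hh] using norm_iteratedFDeriv_le_ultraNorm hσ hh hφ 0 x

/-- The growth condition on the slices of `F` near the edge, in terms of the Legendre transform of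
`b x ^ σ log x`. -/
def HasGrowth (F : EuclideanSpace ℂ (Fin d) → ℂ) (U : Opens (EuclideanSpace ℝ (Fin d)))
    (Γ : Set (EuclideanSpace ℝ (Fin d))) (σ b r : ℝ) : Prop :=
  ∃ A, 0 ≤ A ∧ ∀ n, ∀ x ∈ U, ∀ y ∈ Γ, radius σ b n ≤ ‖y‖ → ‖y‖ < r →
    ‖F (cpoint x y)‖ ≤ A * growth σ b n

/-- On test functions supported in a fixed compact set, the slices are equicontinuous and have
limits, with a linear rate. -/
theorem exists_limit_pairing (hΓ : IsOpen Γ) (hcone : ∀ y ∈ Γ, ∀ t : ℝ, 0 < t → t • y ∈ Γ)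
    (hconn : IsPreconnected Γ) (hF : AnalyticOnNhd ℂ F (wedge U Γ γ)) {σ τ h b r : ℝ}
    (hσ : 1 < σ) (hh : 0 < h) (hb : 0 < b) (hτb : τ < b) (hr : 0 < r) (hrγ : r ≤ γ)
    (hgr : HasGrowth F U Γ σ b r) {K : Set (EuclideanSpace ℝ (Fin d))} (hK : IsCompact K)
    (hKU : K ⊆ U) :
    ∃ C, 0 ≤ C ∧ ∀ φ : 𝓓(U, ℂ), tsupport φ ⊆ K → ultraNorm τ σ h φ < ∞ →
      (∀ y ∈ Γ, y ≠ 0 → ‖y‖ < r / 2 → ‖pairing F y φ‖ ≤ C * (ultraNorm τ σ h φ).toReal) ∧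
      ∃ u : ℂ, ∀ y ∈ Γ, ‖y‖ < r / 2 →
        ‖pairing F y φ - u‖ ≤ C * (ultraNorm τ σ h φ).toReal * ‖y‖ := by
  obtain ⟨A, hA0, hA⟩ := hgr
  have hD : (0 : ℝ) < (d : ℝ) + 1 := by positivity
  obtain ⟨C₁, hC₁0, hC₁⟩ := norm_pairing_le_of_growth hΓ hcone hF hσ hb
    (m := fun n => ((d : ℝ) + 1) ^ n * weight τ σ h n)
    (fun n => mul_nonneg (by positivity) (weight_nonneg _ _ hh.le n))
    (summable_weight hσ hh hD hτb) hr hrγ hA hA0 hK hKU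
  -- The shifted sequence is the one satisfied by first derivatives of the test function; `C₂` will
  -- bound the gradient of the pairing in `y`.
  obtain ⟨C₂, hC₂0, hC₂⟩ := norm_pairing_le_of_growth hΓ hcone hF hσ hb
    (m := fun n => ((d : ℝ) + 1) ^ (n + 1) * weight τ σ h (n + 1))
    (fun n => mul_nonneg (by positivity) (weight_nonneg _ _ hh.le _))
    (summable_weight_succ hσ hh hD hτb) hr hrγ hA hA0 hK hKU
  refine ⟨max C₁ C₂, le_max_of_le_left hC₁0, fun φ hs hφ => ?_⟩
  set N := (ultraNorm τ σ h φ).toReal with hN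
  have hN0 : 0 ≤ N := ENNReal.toReal_nonneg
  have hφs : ContDiff ℝ (⊤ : ℕ∞) φ := φ.contDiff
  have hbd := norm_iteratedFDeriv_le_ultraNorm hσ hh hφ
  refine ⟨fun y hy hy0 hyr => (hC₁ φ N hφs hs hN0 hbd y hy hy0 hyr).trans
    (mul_le_mul_of_nonneg_right (le_max_left _ _) hN0), ?_⟩
  have hder := fun y (hy : y ∈ Γ) (hyγ : ‖y‖ < γ) => hasFDerivAt_pairing hΓ hF hy hyγ
    (ψ := φ) (hφs.of_le (by exact_mod_cast le_top)) φ.hasCompactSupport φ.tsupport_subset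
  refine exists_limit_at_apex hΓ hcone hconn (half_pos hr) (fun y hy hy0 hyr => ?_) fun h0 => ?_
  · obtain ⟨D, hD, hDv⟩ := hder y hy (by linarith)
    refine ⟨D, hD, D.opNorm_le_bound (by positivity) fun v => ?_⟩
    rw [hDv, norm_mul, norm_neg, Complex.norm_I, one_mul]
    refine (hC₂ (dirDeriv v φ) (‖v‖ * N) (contDiff_dirDeriv v hφs)
      ((tsupport_dirDeriv_subset v φ).trans hs) (by positivity) (fun n x => ?_) y hy hy0
      hyr).trans ?_
    · refine (norm_iteratedFDeriv_dirDeriv_le v hφs n x).trans ?_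
      rw [mul_assoc]
      exact mul_le_mul_of_nonneg_left (hbd (n + 1) x) (norm_nonneg v)
    · calc C₂ * (‖v‖ * N) ≤ max C₁ C₂ * (‖v‖ * N) := by gcongr; exact le_max_right _ _
        _ = _ := by ring
  · obtain ⟨D, hD, -⟩ := hder 0 h0 (by rw [norm_zero]; linarith)
    exact hD.continuousAt

/-- The slice of `F` at height `y` as a linear functional on a space of test functions. -/
def sliceFunctional {X : Type*} [AddCommGroup X] [Module ℂ X] (j : X →ₗ[ℂ] 𝓓(U, ℂ))
    (hF : AnalyticOnNhd ℂ F (wedge U Γ γ)) {y : EuclideanSpace ℝ (Fin d)} (hy : y ∈ Γ)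
    (hyγ : ‖y‖ < γ) : X →ₗ[ℂ] ℂ where
  toFun φ := pairing F y (j φ)
  map_add' φ ψ := by
    have h := fun χ : 𝓓(U, ℂ) => integrable_pairing hF hy hyγ χ.contDiff.continuous
      χ.hasCompactSupport χ.tsupport_subset
    have e : ⇑(j (φ + ψ)) = ⇑(j φ) + ⇑(j ψ) := by rw [map_add]; rfl
    simp only [pairing, e, Pi.add_apply, mul_add]
    exact integral_add (h _) (h _)
  map_smul' c φ := by
    have e : ⇑(j (c • φ)) = c • ⇑(j φ) := by rw [map_smul]; rfl
    simp only [pairing, e, Pi.smul_apply, smul_eq_mul, RingHom.id_apply, mul_left_comm _ c]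
    exact integral_const_mul _ _

lemma neBot_nhdsWithin_cone (hcone : ∀ y ∈ Γ, ∀ t : ℝ, 0 < t → t • y ∈ Γ)
    {y : EuclideanSpace ℝ (Fin d)} (hy : y ∈ Γ) (hy0 : y ≠ 0) : (𝓝[Γ \ {0}] 0).NeBot := by
  have h1 : Tendsto (fun s : ℝ => s • y) (𝓝[>] 0) (𝓝 ((0 : ℝ) • y)) :=
    (tendsto_id.smul_const y).mono_left nhdsWithin_le_nhds
  rw [zero_smul] at h1
  refine (tendsto_nhdsWithin_iff.2 ⟨h1, ?_⟩).neBot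
  filter_upwards [self_mem_nhdsWithin] with s hs
  exact ⟨hcone y hy s hs, smul_ne_zero (ne_of_gt hs) hy0⟩

/-- Boundary values exist in the dual of any space of test functions whose topology is fine enough
relative to the norms with parameters in `S`, if the growth of `F` is compatible with `S`. -/
theorem hasBoundaryValue_of_hasGrowth {X : Type*} [AddCommGroup X] [Module ℂ X]
    [TopologicalSpace X] [IsTopologicalAddGroup X] (j : X →ₗ[ℂ] 𝓓(U, ℂ)) (hΓ : IsOpen Γ)
    (hcone : ∀ y ∈ Γ, ∀ t : ℝ, 0 < t → t • y ∈ Γ) (hconn : IsPreconnected Γ)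
    (hF : AnalyticOnNhd ℂ F (wedge U Γ γ)) {σ r : ℝ} (hσ : 1 < σ) (hr : 0 < r) (hrγ : r ≤ γ)
    (S : Set (ℝ × ℝ)) (hS : ∀ q ∈ S, 0 < q.2)
    (hfin : ∀ φ, ∃ q ∈ S, ultraNorm q.1 σ q.2 (j φ) < ∞)
    (hcont : ∀ p : Seminorm ℂ X, (∀ K : Compacts (EuclideanSpace ℝ (Fin d)),
      (K : Set (EuclideanSpace ℝ (Fin d))) ⊆ U → ∀ q ∈ S, ∃ C : ℝ, ∀ φ, tsupport (j φ) ⊆ K →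
      ultraNorm q.1 σ q.2 (j φ) < ∞ → p φ ≤ C * (ultraNorm q.1 σ q.2 (j φ)).toReal) →
      Continuous p)
    (hgr : ∀ q ∈ S, ∃ b, 0 < b ∧ q.1 < b ∧ HasGrowth F U Γ σ b r) :
    HasBoundaryValue j Γ γ F := by
  have hfy : ∀ y, ∃ f : X →L[ℂ] ℂ, y ∈ Γ → ‖y‖ < γ → ∀ φ, f φ = pairing F y (j φ) := by
    intro y
    by_cases h : y ∈ Γ ∧ ‖y‖ < γ
    · obtain ⟨hy, hyγ⟩ := h
      refine ⟨⟨sliceFunctional j hF hy hyγ, continuous_of_norm_le_seminorm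
        (p := (normSeminorm ℂ ℂ).comp (sliceFunctional j hF hy hyγ))
        (hcont _ fun K hKU q hq => ?_) fun φ => le_rfl⟩, fun _ _ φ => rfl⟩
      -- For a single height `y` the growth of `F` plays no role: the slice is bounded on each
      -- compact subset of `U`.
      obtain ⟨a, ha⟩ := K.isCompact.exists_bound_of_continuousOn
        (f := fun x => F (cpoint x y)) fun x hx => (continuousAt_slice
          (fun z hz => (hF z hz).continuousAt) (hKU hx) hy hyγ).continuousWithinAt
      refine ⟨a * volume.real (K : Set (EuclideanSpace ℝ (Fin d))), fun φ hs hφ => ?_⟩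
      exact (norm_pairing_le K.isCompact hs ha
        (norm_le_ultraNorm hσ (hS q hq) hφ)).trans_eq (by ring)
    · exact ⟨0, fun h1 h2 => absurd ⟨h1, h2⟩ h⟩
  choose f hf using hfy
  refine ⟨f, hf, ?_⟩
  have hest : ∀ K : Compacts (EuclideanSpace ℝ (Fin d)),
      (K : Set (EuclideanSpace ℝ (Fin d))) ⊆ U → ∀ q ∈ S, ∃ C : ℝ, 0 ≤ C ∧
      ∀ φ, tsupport (j φ) ⊆ K → ultraNorm q.1 σ q.2 (j φ) < ∞ →
      (∀ y ∈ Γ, y ≠ 0 → ‖y‖ < r / 2 →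
        ‖f y φ‖ ≤ C * (ultraNorm q.1 σ q.2 (j φ)).toReal) ∧
      ∃ u : ℂ, ∀ y ∈ Γ, ‖y‖ < r / 2 →
        ‖f y φ - u‖ ≤ C * (ultraNorm q.1 σ q.2 (j φ)).toReal * ‖y‖ := by
    intro K hKU q hq
    obtain ⟨b, hb, hqb, hg⟩ := hgr q hq
    obtain ⟨C, hC0, hC⟩ := exists_limit_pairing hΓ hcone hconn hF hσ (hS q hq) hb hqb hr hrγ hg
      K.isCompact hKU
    refine ⟨C, hC0, fun φ hs hφ => ?_⟩
    obtain ⟨h1, u, h2⟩ := hC (j φ) hs hφ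
    exact ⟨fun y hy hy0 hyr => by rw [hf y hy (by linarith)]; exact h1 y hy hy0 hyr,
      u, fun y hy hyr => by rw [hf y hy (by linarith)]; exact h2 y hy hyr⟩
  by_cases hne : ∃ y ∈ Γ, y ≠ 0
  swap
  · push Not at hne
    -- A cone without nonzero points gives a filter below the pure filter at `0`, and convergence is
    -- trivial.
    refine ⟨f 0, (tendsto_pure_nhds f 0).mono_left ?_⟩
    rw [← nhdsWithin_singleton]
    exact nhdsWithin_mono _ fun y hy => hne y hy
  obtain ⟨y₁, hy₁, hy₁0⟩ := hne
  have hnb := neBot_nhdsWithin_cone hcone hy₁ hy₁0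
  have hsmall : ∀ᶠ y in 𝓝 (0 : EuclideanSpace ℝ (Fin d)), ‖y‖ < r / 2 := by
    filter_upwards [Metric.ball_mem_nhds 0 (half_pos hr)] with y hy
    simpa using hy
  have htend : ∀ φ u c, (∀ y ∈ Γ, ‖y‖ < r / 2 → ‖f y φ - u‖ ≤ c * ‖y‖) →
      Tendsto (fun y => f y φ) (𝓝[Γ \ {0}] 0) (𝓝 u) := by
    intro φ u c h
    rw [tendsto_iff_norm_sub_tendsto_zero]
    have h1 : Tendsto (fun y : EuclideanSpace ℝ (Fin d) => c * ‖y‖) (𝓝[Γ \ {0}] 0) (𝓝 0) := by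
      have : Tendsto (fun y : EuclideanSpace ℝ (Fin d) => c * ‖y‖) (𝓝 0) (𝓝 (c * ‖(0 :
        EuclideanSpace ℝ (Fin d))‖)) := Continuous.tendsto (by fun_prop) 0
      rw [norm_zero, mul_zero] at this
      exact this.mono_left nhdsWithin_le_nhds
    refine squeeze_zero' (Eventually.of_forall fun _ => norm_nonneg _) ?_ h1
    filter_upwards [self_mem_nhdsWithin, nhdsWithin_le_nhds hsmall] with y hy hyr
    exact h y hy.1 hyr
  have hlim : ∀ φ, ∃ u, ∃ c, ∀ y ∈ Γ, ‖y‖ < r / 2 → ‖f y φ - u‖ ≤ c * ‖y‖ := fun φ => by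
    obtain ⟨q, hq, hφ⟩ := hfin φ
    -- For pointwise limits the support of `φ` itself serves as the compact set.
    obtain ⟨C, -, hC⟩ := hest ⟨tsupport (j φ), (j φ).hasCompactSupport⟩ (j φ).tsupport_subset q hq
    obtain ⟨u, hu⟩ := (hC φ subset_rfl hφ).2
    exact ⟨u, _, hu⟩
  choose u c hu using hlim
  have hut := fun φ => htend φ _ _ (hu φ)
  set uL : X →ₗ[ℂ] ℂ := linearMapOfTendsto (l := 𝓝[Γ \ {0}] 0) u
    (fun y => (f y : X →ₗ[ℂ] ℂ)) (tendsto_pi_nhds.2 hut) with huL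
  have huLa : ∀ φ, uL φ = u φ := fun φ => rfl
  have hrate : ∀ K : Compacts (EuclideanSpace ℝ (Fin d)),
      (K : Set (EuclideanSpace ℝ (Fin d))) ⊆ U → ∀ q ∈ S, ∃ C : ℝ, 0 ≤ C ∧
      ∀ φ, tsupport (j φ) ⊆ K → ultraNorm q.1 σ q.2 (j φ) < ∞ →
      ‖u φ‖ ≤ C * (ultraNorm q.1 σ q.2 (j φ)).toReal ∧
      ∀ y ∈ Γ, ‖y‖ < r / 2 →
        ‖f y φ - u φ‖ ≤ C * (ultraNorm q.1 σ q.2 (j φ)).toReal * ‖y‖ := by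
    intro K hKU q hq
    obtain ⟨C, hC0, hC⟩ := hest K hKU q hq
    refine ⟨C, hC0, fun φ hs hφ => ?_⟩
    obtain ⟨h1, v, hv⟩ := hC φ hs hφ
    obtain rfl : v = u φ := tendsto_nhds_unique (htend φ _ _ hv) (hut φ)
    refine ⟨le_of_tendsto (hut φ).norm ?_, hv⟩
    filter_upwards [self_mem_nhdsWithin, nhdsWithin_le_nhds hsmall] with y hy hyr
    exact h1 y hy.1 hy.2 hyr
  have huc : Continuous uL := continuous_of_norm_le_seminorm
    (p := (normSeminorm ℂ ℂ).comp uL) (hcont _ fun K hKU q hq => by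
      obtain ⟨C, -, hC⟩ := hrate K hKU q hq
      exact ⟨C, fun φ hs hφ => (hC φ hs hφ).1⟩) fun φ => le_rfl
  -- The difference quotients `|f y φ - u φ| / |y|` are pointwise bounded by the linear rate. Their
  -- supremum satisfies the bound in `hcont` on every compact set and for every norm in `S`, so it
  -- is a continuous seminorm valid for all test functions at once.
  let P : {y : EuclideanSpace ℝ (Fin d) // y ∈ Γ ∧ y ≠ 0 ∧ ‖y‖ < r / 2} → Seminorm ℂ X :=
    fun y => (normSeminorm ℂ ℂ).comp (((‖(y : EuclideanSpace ℝ (Fin d))‖⁻¹ : ℝ) : ℂ) •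
      ((f y : X →ₗ[ℂ] ℂ) - uL))
  have hPa : ∀ y φ, P y φ = ‖(y : EuclideanSpace ℝ (Fin d))‖⁻¹ * ‖f y φ - u φ‖ := fun y φ => by
    change ‖((‖(y : EuclideanSpace ℝ (Fin d))‖⁻¹ : ℝ) : ℂ) * (f y φ - u φ)‖ = _
    rw [norm_mul, Complex.norm_real, norm_inv, norm_norm]
  have hPb : ∀ y φ c, (∀ y ∈ Γ, ‖y‖ < r / 2 → ‖f y φ - u φ‖ ≤ c * ‖y‖) → P y φ ≤ c := by
    intro y φ c h
    have hy0 := norm_pos_iff.2 y.2.2.1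
    rw [hPa, inv_mul_le_iff₀ hy0, mul_comm]
    exact h y y.2.1 y.2.2.2
  have hbdd : BddAbove (Set.range P) := Seminorm.bddAbove_range_iff.2 fun φ => by
    refine ⟨c φ, ?_⟩
    rintro _ ⟨y, rfl⟩
    exact hPb y φ _ (hu φ)
  have hPc : Continuous (⨆ y, P y : Seminorm ℂ X) := hcont _ fun K hKU q hq => by
    obtain ⟨C, hC0, hC⟩ := hrate K hKU q hq
    refine ⟨C, fun φ hs hφ => ?_⟩
    rw [Seminorm.iSup_apply hbdd]
    exact Real.iSup_le (fun y => hPb y φ _ (hC φ hs hφ).2)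
      (mul_nonneg hC0 ENNReal.toReal_nonneg)
  refine ⟨⟨uL, huc⟩, tendsto_strongDual (ε := fun y => ‖y‖)
    (tendsto_norm_zero.mono_left nhdsWithin_le_nhds) hPc ?_⟩
  filter_upwards [self_mem_nhdsWithin, nhdsWithin_le_nhds hsmall] with y hy hyr φ
  change ‖f y φ - u φ‖ ≤ _
  rcases eq_or_ne y 0 with rfl | hy0
  -- If `0 ∈ Γ`, the linear rate at `y = 0` forces the slice at `0` to equal the limit.
  · simpa using hu φ 0 hy hyr
  · rw [Seminorm.iSup_apply hbdd]
    have h1 := le_ciSup (Seminorm.bddAbove_range_iff.1 hbdd φ) ⟨y, hy, hy0, hyr⟩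
    rwa [hPa, inv_mul_le_iff₀ (norm_pos_iff.2 hy0)] at h1

end BoundaryValue

/-! ### Growth conditions -/

section Growth

variable {d : ℕ} {U : Opens (EuclideanSpace ℝ (Fin d))} {Γ : Set (EuclideanSpace ℝ (Fin d))}
  {F : EuclideanSpace ℂ (Fin d) → ℂ}

lemma hasGrowth_of_exists {σ b r A : ℝ} (hσ : 1 < σ) (hb : 0 < b) (hA : 0 ≤ A)
    (h : ∀ x ∈ U, ∀ y ∈ Γ, y ≠ 0 → ‖y‖ < r → ∃ p : ℕ,
      ‖F (cpoint x y)‖ ≤ A * Real.exp (p * Real.log (1 / ‖y‖) - b * logWeight σ p)) :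
    HasGrowth F U Γ σ b r := by
  refine ⟨A, hA, fun n x hx y hy hny hyr => ?_⟩
  obtain ⟨p, hp⟩ := h x hx y hy (norm_pos_iff.1 ((radius_pos σ b n).trans_le hny)) hyr
  exact hp.trans (mul_le_mul_of_nonneg_left (exp_le_growth hσ hb hny p) hA)

lemma log_assocFun_term {τ σ h k : ℝ} (hσ : 1 < σ) (hh : 0 < h) (hk : 0 < k) (p : ℕ) :
    Real.log (h ^ ((p : ℝ) ^ σ) * k ^ p / (p : ℝ) ^ (τ * (p : ℝ) ^ σ)) =
      (p : ℝ) ^ σ * Real.log h + p * Real.log k - τ * logWeight σ p := by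
  have e : (p : ℝ) ^ (τ * (p : ℝ) ^ σ) = Real.exp (τ * logWeight σ p) := by
    simpa [weight] using weight_eq_exp (τ := τ) hσ one_pos p
  have hpos : 0 < h ^ ((p : ℝ) ^ σ) := Real.rpow_pos_of_pos hh _
  rw [e, Real.log_div (by positivity) (Real.exp_pos _).ne', Real.log_exp,
    Real.log_mul hpos.ne' (by positivity), Real.log_rpow hh, Real.log_pow]

/-- The expression is `p ^ σ (a - c log p)`, which is nonpositive once `log p ≥ a / c`. This lets a
slightly smaller coefficient of `ψ` absorb any power `H ^ (p ^ σ)`. -/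
lemma exists_bound_rpow_mul_sub {σ c : ℝ} (a : ℝ) (hσ : 1 < σ) (hc : 0 < c) :
    ∃ C, ∀ p : ℕ, (p : ℝ) ^ σ * a - c * logWeight σ p ≤ C := by
  refine ⟨Real.exp (σ * (|a| / c)) * |a|, fun p => ?_⟩
  have hσ0 : 0 < σ := by linarith
  have hC : 0 ≤ Real.exp (σ * (|a| / c)) * |a| := by positivity
  rcases Nat.eq_zero_or_pos p with rfl | hp
  · simpa [logWeight_zero, Real.zero_rpow hσ0.ne'] using hC
  have hp' : (0 : ℝ) < p := by exact_mod_cast hp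
  have hps : (0 : ℝ) < (p : ℝ) ^ σ := by positivity
  have e : (p : ℝ) ^ σ * a - c * logWeight σ p = (p : ℝ) ^ σ * (a - c * Real.log p) := by
    rw [logWeight]; ring
  rw [e]
  rcases le_total a (c * Real.log p) with h | h
  · exact (mul_nonpos_of_nonneg_of_nonpos hps.le (by linarith)).trans hC
  · have hl : 0 ≤ c * Real.log p := mul_nonneg hc.le (Real.log_natCast_nonneg p)
    have h1 : Real.log p ≤ |a| / c := by
      rw [le_div_iff₀ hc]; linarith [le_abs_self a]
    refine mul_le_mul ?_ (by linarith [le_abs_self a]) (by linarith) (Real.exp_pos _).le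
    rw [Real.rpow_def_of_pos hp', mul_comm]
    gcongr

lemma hasGrowth_of_assocFun {σ b τ H A r : ℝ} (hσ : 1 < σ) (hb : 0 < b) (hbτ : b < τ)
    (hH : 0 < H) (hA : 0 < A)
    (h : ∀ x ∈ U, ∀ y ∈ Γ, y ≠ 0 → ‖y‖ < r →
      ‖F (cpoint x y)‖ ≤ A * Real.exp (assocFun τ σ H (1 / ‖y‖))) :
    HasGrowth F U Γ σ b r := by
  obtain ⟨C, hC⟩ := exists_bound_rpow_mul_sub (Real.log H) hσ (sub_pos.2 hbτ)
  refine hasGrowth_of_exists (A := A * Real.exp (C + 1)) hσ hb (by positivity)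
    fun x hx y hy hy0 hyr => ?_
  have hk : 0 < 1 / ‖y‖ := one_div_pos.2 (norm_pos_iff.2 hy0)
  -- A term within `1` of the supremum suffices; the loss is the `+ 1` in the constant.
  obtain ⟨p, hp⟩ := exists_lt_of_lt_ciSup (sub_one_lt (assocFun τ σ H (1 / ‖y‖)))
  rw [log_assocFun_term hσ hH hk] at hp
  refine ⟨p, (h x hx y hy hy0 hyr).trans ?_⟩
  rw [mul_assoc, ← Real.exp_add]
  gcongr
  linarith [hC p]

/-- The Legendre transform of `b ψ` at `L` has the order of `L q` with `q = (L / log L) ^ (1 / (σ -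
1))`. Testing with `p` near `2 H q` makes `p L` at least `2 H q L`, and `hbH` ensures that `b ψ(p)`
takes back at most half of that. -/
lemma exists_nat_legendre_ge {σ H b : ℝ} (hσ : 1 < σ) (hH : 0 < H) (hb : 0 < b)
    (hbH : b * (4 * H) ^ σ * (2 / (σ - 1)) ≤ H) :
    ∃ C, ∀ L : ℝ, 2 ≤ L → ∃ p : ℕ,
      H * L * (L / Real.log L) ^ (1 / (σ - 1)) ≤ C + (p * L - b * logWeight σ p) := by
  have hσ1 : 0 < σ - 1 := by linarith
  have hs : 0 < 1 / (σ - 1) := by positivity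
  have hdiv : Tendsto (fun L : ℝ => L / Real.log L) atTop atTop := by
    refine ((Real.tendsto_exp_div_pow_atTop 1).comp Real.tendsto_log_atTop).congr' ?_
    filter_upwards [eventually_gt_atTop 0] with L hL
    simp [Real.exp_log hL]
  have hq : Tendsto (fun L : ℝ => (L / Real.log L) ^ (1 / (σ - 1))) atTop atTop :=
    (tendsto_rpow_atTop hs).comp hdiv
  -- For large `L`: rounding up `2 H q` at most doubles it, and `log p ≤ (2 / (σ - 1)) log L`.
  have hev : ∀ᶠ L : ℝ in atTop, 1 / (2 * H) ≤ (L / Real.log L) ^ (1 / (σ - 1)) ∧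
      Real.log (4 * H) ≤ 1 / (σ - 1) * Real.log L ∧ 1 ≤ Real.log L :=
    (hq.eventually_ge_atTop _).and
      (((Real.tendsto_log_atTop.const_mul_atTop hs).eventually_ge_atTop _).and
        (Real.tendsto_log_atTop.eventually_ge_atTop 1))
  obtain ⟨L₀, hL₀⟩ := eventually_atTop.1 hev
  set M := max L₀ 2 with hM
  have hM2 : 2 ≤ M := le_max_right _ _
  have hl2 : 0 < Real.log 2 := Real.log_pos one_lt_two
  have hC0 : 0 ≤ H * M * (M / Real.log 2) ^ (1 / (σ - 1)) := by positivity
  refine ⟨H * M * (M / Real.log 2) ^ (1 / (σ - 1)), fun L hL => ?_⟩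
  rcases le_total L M with hLM | hLM
  -- On the bounded range `2 ≤ L ≤ M` the left side is bounded, so the constant alone does the work.
  · refine ⟨0, ?_⟩
    have hlL : Real.log 2 ≤ Real.log L := Real.log_le_log two_pos hL
    have hlL0 : 0 < Real.log L := hl2.trans_le hlL
    simp only [Nat.cast_zero, zero_mul, logWeight_zero, mul_zero, sub_zero, add_zero]
    gcongr
  have hL0 : 0 < L := by linarith
  obtain ⟨h1, h2, h3⟩ := hL₀ L ((le_max_left _ _).trans hLM)
  have hl0 : 0 < Real.log L := by linarith
  set q := (L / Real.log L) ^ (1 / (σ - 1)) with hqdef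
  have hq0 : 0 < q := by positivity
  have h1' : 1 ≤ 2 * H * q := by
    rw [div_le_iff₀ (by positivity)] at h1; linarith
  refine ⟨⌈2 * H * q⌉₊, ?_⟩
  set p := ⌈2 * H * q⌉₊ with hp
  have hp1 : 2 * H * q ≤ p := Nat.le_ceil _
  have hp2 : (p : ℝ) ≤ 4 * H * q := by
    have := (Nat.ceil_lt_add_one (by positivity : 0 ≤ 2 * H * q)).le
    linarith
  have hp0 : (1 : ℝ) ≤ p := h1'.trans hp1
  have hlog : Real.log p ≤ 2 / (σ - 1) * Real.log L := by
    refine (Real.log_le_log (by linarith) hp2).trans ?_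
    rw [Real.log_mul (by positivity) hq0.ne', hqdef, Real.log_rpow (by positivity),
      Real.log_div hL0.ne' hl0.ne']
    have h4 : 0 ≤ 1 / (σ - 1) * Real.log (Real.log L) := mul_nonneg hs.le (Real.log_nonneg h3)
    have h5 : 2 / (σ - 1) = 1 / (σ - 1) + 1 / (σ - 1) := by ring
    rw [h5]
    linarith
  -- The exponent `1 / (σ - 1)` is chosen for this: the factor `log L` in the bound for `ψ(p)`
  -- cancels, leaving a multiple of `q L`.
  have hqσ : q ^ σ = q * (L / Real.log L) := by
    have h6 : q ^ (σ - 1) = L / Real.log L := by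
      rw [hqdef, ← Real.rpow_mul (by positivity), one_div_mul_cancel hσ1.ne', Real.rpow_one]
    rw [← h6, Real.rpow_sub_one hq0.ne']
    field_simp
  have hw : b * logWeight σ p ≤ H * (q * L) := by
    calc b * logWeight σ p ≤ b * ((4 * H * q) ^ σ * (2 / (σ - 1) * Real.log L)) := by
          rw [logWeight]
          gcongr
      _ = b * (4 * H) ^ σ * (2 / (σ - 1)) * (q * L) := by
          rw [Real.mul_rpow (by positivity) hq0.le, hqσ]
          field_simp
      _ ≤ H * (q * L) := by gcongr
  have h7 : 2 * H * q * L ≤ p * L := by gcongr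
  linarith

/-- The radius `exp (-2)` keeps `log (1 / |y|) ≥ 2`, so that the iterated logarithm in the
denominator stays away from `0`. -/
lemma hasGrowth_of_log_bound {σ b H A γ : ℝ} (hσ : 1 < σ) (hb : 0 < b) (hH : 0 < H)
    (hbH : b * (4 * H) ^ σ * (2 / (σ - 1)) ≤ H) (hA : 0 < A)
    (h : ∀ x ∈ U, ∀ y ∈ Γ, y ≠ 0 → ‖y‖ < γ → ‖y‖ < Real.exp (-1) →
      ‖F (cpoint x y)‖ ≤ A * ‖y‖ ^
        (-(H * (Real.log (1 / ‖y‖) / Real.log (Real.log (1 / ‖y‖))) ^ (1 / (σ - 1))))) :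
    HasGrowth F U Γ σ b (min γ (Real.exp (-2))) := by
  obtain ⟨C, hC⟩ := exists_nat_legendre_ge hσ hH hb hbH
  refine hasGrowth_of_exists (A := A * Real.exp C) hσ hb (by positivity)
    fun x hx y hy hy0 hyr => ?_
  have hn : 0 < ‖y‖ := norm_pos_iff.2 hy0
  have hy2 : ‖y‖ < Real.exp (-2) := hyr.trans_le (min_le_right _ _)
  have hL : 2 ≤ Real.log (1 / ‖y‖) := by
    have := Real.log_le_log hn hy2.le
    rw [Real.log_exp] at this
    rw [one_div, Real.log_inv]
    linarith
  obtain ⟨p, hp⟩ := hC _ hL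
  refine ⟨p, (h x hx y hy hy0 (hyr.trans_le (min_le_left _ _))
    (hy2.trans (Real.exp_lt_exp.2 (by norm_num)))).trans ?_⟩
  rw [mul_assoc, ← Real.exp_add, Real.rpow_def_of_pos hn]
  gcongr
  refine le_trans (le_of_eq ?_) hp
  have e : Real.log ‖y‖ = -Real.log (1 / ‖y‖) := by rw [one_div, Real.log_inv, neg_neg]
  rw [e]
  ring

end Growth

/-! ### The four spaces of test functions -/

section Spaces

variable {d : ℕ} {U : Opens (EuclideanSpace ℝ (Fin d))} {Γ : Set (EuclideanSpace ℝ (Fin d))}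
  {γ : ℝ} {F : EuclideanSpace ℂ (Fin d) → ℂ}

instance (τ σ : ℝ) : IsTopologicalAddGroup (BeurlingSpace U τ σ) :=
  isTopologicalAddGroup_seminormTopology _

instance (τ σ : ℝ) (hτ : 0 < τ) : IsTopologicalAddGroup (RoumieuSpace U τ σ hτ) :=
  isTopologicalAddGroup_seminormTopology _

instance (σ : ℝ) : IsTopologicalAddGroup (RoumieuLimitSpace U σ) :=
  isTopologicalAddGroup_seminormTopology _

/-- Boundary values pass to the dual of a space that maps continuously into `Y`. -/
lemma HasBoundaryValue.comp {X Y : Type*} [AddCommGroup X] [Module ℂ X] [TopologicalSpace X]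
    [AddCommGroup Y] [Module ℂ Y] [TopologicalSpace Y] {j : Y →ₗ[ℂ] 𝓓(U, ℂ)}
    (h : HasBoundaryValue j Γ γ F) (T : X →L[ℂ] Y) :
    HasBoundaryValue (j.comp (T : X →ₗ[ℂ] Y)) Γ γ F := by
  obtain ⟨f, hf, u, hu⟩ := h
  refine ⟨fun y => (f y).comp T, fun y hy hyγ φ => hf y hy hyγ (T φ), u.comp T, ?_⟩
  refine (UniformConvergenceCLM.tendsto_iff_tendstoUniformlyOn (F := ℂ) (σ := RingHom.id ℂ)
    {s : Set X | Bornology.IsVonNBounded ℂ s}).2 fun s hs => ?_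
  have h1 := (UniformConvergenceCLM.tendsto_iff_tendstoUniformlyOn (F := ℂ) (σ := RingHom.id ℂ)
    {s : Set Y | Bornology.IsVonNBounded ℂ s}).1 hu (T '' s) (hs.image T)
  exact (h1.comp T).mono (Set.subset_preimage_image T s)

lemma hasBoundaryValue_beurling (hΓ : IsOpen Γ) (hcone : ∀ y ∈ Γ, ∀ t : ℝ, 0 < t → t • y ∈ Γ)
    (hconn : IsPreconnected Γ) (hF : AnalyticOnNhd ℂ F (wedge U Γ γ)) {σ r τ b : ℝ}
    (hσ : 1 < σ) (hr : 0 < r) (hrγ : r ≤ γ) (hb : 0 < b) (hτb : τ < b)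
    (hgr : HasGrowth F U Γ σ b r) :
    HasBoundaryValue (BeurlingSpace.incl U τ σ) Γ γ F := by
  -- One norm, with `h = 1`, is enough: it is finite on the whole space, and a seminorm it dominates
  -- on each compact set is continuous.
  refine hasBoundaryValue_of_hasGrowth _ hΓ hcone hconn hF hσ hr hrγ {(τ, 1)} ?_ ?_ ?_ ?_
  · rintro _ rfl; exact one_pos
  · exact fun φ => ⟨_, rfl, φ.2 1 one_pos⟩
  · refine fun p hp => continuous_of_mem_seminormTopology fun K hK => ⟨1, one_pos, ?_⟩
    obtain ⟨C, hC⟩ := hp K hK _ rfl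
    exact ⟨C, fun φ hφ => hC φ hφ (φ.2 1 one_pos)⟩
  · rintro _ rfl; exact ⟨b, hb, hτb, hgr⟩

lemma hasBoundaryValue_roumieu (hΓ : IsOpen Γ) (hcone : ∀ y ∈ Γ, ∀ t : ℝ, 0 < t → t • y ∈ Γ)
    (hconn : IsPreconnected Γ) (hF : AnalyticOnNhd ℂ F (wedge U Γ γ)) {σ r τ b : ℝ}
    (hσ : 1 < σ) (hr : 0 < r) (hrγ : r ≤ γ) (hτ : 0 < τ) (hτb : τ < b)
    (hgr : HasGrowth F U Γ σ b r) :
    HasBoundaryValue (RoumieuSpace.incl U τ σ hτ) Γ γ F := by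
  refine hasBoundaryValue_of_hasGrowth _ hΓ hcone hconn hF hσ hr hrγ
    {q | q.1 = τ ∧ 0 < q.2} ?_ ?_ ?_ ?_
  · exact fun q hq => hq.2
  · rintro φ
    obtain ⟨h, hh, hφ⟩ := φ.2
    exact ⟨(τ, h), ⟨rfl, hh⟩, hφ⟩
  · exact fun p hp => continuous_of_mem_seminormTopology fun K hK h hh =>
      hp K hK (τ, h) ⟨rfl, hh⟩
  · rintro q ⟨hq, -⟩; exact ⟨b, hτ.trans hτb, hq ▸ hτb, hgr⟩

lemma hasBoundaryValue_roumieuLimit (hΓ : IsOpen Γ)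
    (hcone : ∀ y ∈ Γ, ∀ t : ℝ, 0 < t → t • y ∈ Γ) (hconn : IsPreconnected Γ)
    (hF : AnalyticOnNhd ℂ F (wedge U Γ γ)) {σ r : ℝ} (hσ : 1 < σ) (hr : 0 < r) (hrγ : r ≤ γ)
    (hgr : ∀ τ, 0 < τ → ∃ b, τ < b ∧ HasGrowth F U Γ σ b r) :
    HasBoundaryValue (RoumieuLimitSpace.incl U σ) Γ γ F := by
  refine hasBoundaryValue_of_hasGrowth _ hΓ hcone hconn hF hσ hr hrγ
    {q | 0 < q.1 ∧ 0 < q.2} ?_ ?_ ?_ ?_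
  · exact fun q hq => hq.2
  · rintro φ
    obtain ⟨τ, hτ, h, hh, hφ⟩ := φ.2
    exact ⟨(τ, h), ⟨hτ, hh⟩, hφ⟩
  -- The topology is a two-stage inductive limit, so continuity is checked first on each
  -- `D_{{τ,σ}}(U)` and there on each normed piece.
  · refine fun p hp => continuous_of_mem_seminormTopology fun τ hτ => ?_
    refine continuous_of_mem_seminormTopology (p := p.comp (RoumieuLimitSpace.ofRoumieu U τ σ hτ))
      fun K hK h hh => ?_
    obtain ⟨C, hC⟩ := hp K hK (τ, h) ⟨hτ, hh⟩
    exact ⟨C, fun φ hφ => hC (RoumieuLimitSpace.ofRoumieu U τ σ hτ φ) hφ⟩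
  · rintro q ⟨hq, -⟩
    obtain ⟨b, hb, h⟩ := hgr q.1 hq
    exact ⟨b, hq.trans hb, hb, h⟩

lemma continuous_toBeurling (τ σ : ℝ) (hτ : 0 < τ) :
    Continuous (BeurlingLimitSpace.toBeurling U τ σ hτ) :=
  continuous_iInf_dom (i := τ) (continuous_iInf_dom (i := hτ) continuous_induced_dom)

lemma HasBoundaryValue.beurlingLimit {τ σ : ℝ} (hτ : 0 < τ)
    (h : HasBoundaryValue (BeurlingSpace.incl U τ σ) Γ γ F) :
    HasBoundaryValue (BeurlingLimitSpace.incl U σ) Γ γ F :=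
  h.comp ⟨BeurlingLimitSpace.toBeurling U τ σ hτ, continuous_toBeurling τ σ hτ⟩

end Spaces

end ExtGevrey

end

/-! ### Choice of parameters in the four cases -/

theorem mainTheorem1 {d : ℕ} (σ : ℝ) (hσ : 1 < σ)
    (U : TopologicalSpace.Opens (EuclideanSpace ℝ (Fin d)))
    (Γ : Set (EuclideanSpace ℝ (Fin d))) (hΓ_open : IsOpen Γ)
    (hΓ_cone : ∀ y ∈ Γ, ∀ t : ℝ, 0 < t → t • y ∈ Γ)
    (hΓ_conn : IsPreconnected Γ)
    (γ : ℝ) (hγ : 0 < γ)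
    (F : EuclideanSpace ℂ (Fin d) → ℂ)
    (hF : AnalyticOnNhd ℂ F (ExtGevrey.wedge U Γ γ)) :
    ((∃ A : ℝ, 0 < A ∧ ∃ H : ℝ, 0 < H ∧
        ∀ x ∈ U, ∀ y ∈ Γ, y ≠ 0 → ‖y‖ < γ → ‖y‖ < Real.exp (-1) →
          ‖F (ExtGevrey.cpoint x y)‖ ≤ A * ‖y‖ ^
            (-(H * (Real.log (1 / ‖y‖) / Real.log (Real.log (1 / ‖y‖))) ^ (1 / (σ - 1))))) →
      ExtGevrey.HasBoundaryValue (ExtGevrey.BeurlingLimitSpace.incl U σ) Γ γ F) ∧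
    ((∀ H : ℝ, 0 < H → ∃ A : ℝ, 0 < A ∧
        ∀ x ∈ U, ∀ y ∈ Γ, y ≠ 0 → ‖y‖ < γ → ‖y‖ < Real.exp (-1) →
          ‖F (ExtGevrey.cpoint x y)‖ ≤ A * ‖y‖ ^
            (-(H * (Real.log (1 / ‖y‖) / Real.log (Real.log (1 / ‖y‖))) ^ (1 / (σ - 1))))) →
      ExtGevrey.HasBoundaryValue (ExtGevrey.RoumieuLimitSpace.incl U σ) Γ γ F) ∧
    (∀ (τ : ℝ) (_ : 0 < τ),
      (∃ A : ℝ, 0 < A ∧ ∃ H : ℝ, 0 < H ∧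
        ∀ x ∈ U, ∀ y ∈ Γ, y ≠ 0 → ‖y‖ < γ →
          ‖F (ExtGevrey.cpoint x y)‖ ≤
            A * Real.exp (ExtGevrey.assocFun ((2 ^ σ - 1) * τ) σ H (1 / ‖y‖))) →
      ExtGevrey.HasBoundaryValue
        (ExtGevrey.BeurlingSpace.incl U (τ / 2 ^ (σ - 1)) σ) Γ γ F) ∧
    (∀ (τ : ℝ) (hτ : 0 < τ),
      (∀ H : ℝ, 0 < H → ∃ A : ℝ, 0 < A ∧
        ∀ x ∈ U, ∀ y ∈ Γ, y ≠ 0 → ‖y‖ < γ →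
          ‖F (ExtGevrey.cpoint x y)‖ ≤
            A * Real.exp (ExtGevrey.assocFun ((2 ^ σ - 1) * τ) σ H (1 / ‖y‖))) →
      ExtGevrey.HasBoundaryValue
        (ExtGevrey.RoumieuSpace.incl U (τ / 2 ^ (σ - 1)) σ
          (div_pos hτ (Real.rpow_pos_of_pos two_pos (σ - 1)))) Γ γ F) := by
  have hσ1 : 0 < σ - 1 := by linarith
  refine ⟨?_, ?_, ?_, ?_⟩
  · rintro ⟨A, hA, H, hH, h⟩
    have hc : 0 < (4 * H) ^ σ * (2 / (σ - 1)) := by positivity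
    -- The largest `b` that the given `H` allows. One `τ < b`, here `b / 2`, suffices, because the
    -- projective limit maps continuously into each of its members.
    have hb : 0 < H / ((4 * H) ^ σ * (2 / (σ - 1))) := by positivity
    have hgr := ExtGevrey.hasGrowth_of_log_bound hσ hb hH
      (by rw [mul_assoc, div_mul_cancel₀ _ hc.ne']) hA h
    exact (ExtGevrey.hasBoundaryValue_beurling hΓ_open hΓ_cone hΓ_conn hF hσ
      (lt_min hγ (Real.exp_pos _)) (min_le_left _ _) hb (half_lt_self hb) hgr).beurlingLimit
      (half_pos hb)
  · intro h
    refine ExtGevrey.hasBoundaryValue_roumieuLimit hΓ_open hΓ_cone hΓ_conn hF hσ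
      (lt_min hγ (Real.exp_pos (-2))) (min_le_left _ _) fun τ hτ => ⟨2 * τ, by linarith, ?_⟩
    have hc : 0 < 2 * τ * 4 ^ σ * (2 / (σ - 1)) := by positivity
    -- Conversely, every `τ` must be reached: `H` solves `b (4 H) ^ σ (2 / (σ - 1)) = H` for `b = 2
    -- τ`.
    set H : ℝ := (2 * τ * 4 ^ σ * (2 / (σ - 1)))⁻¹ ^ (1 / (σ - 1)) with hHdef
    have hH : 0 < H := by positivity
    obtain ⟨A, hA, hb⟩ := h H hH
    refine ExtGevrey.hasGrowth_of_log_bound hσ (by linarith) hH (le_of_eq ?_) hA hb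
    have h1 : H ^ (σ - 1) = (2 * τ * 4 ^ σ * (2 / (σ - 1)))⁻¹ := by
      rw [hHdef, ← Real.rpow_mul (by positivity), one_div_mul_cancel hσ1.ne', Real.rpow_one]
    have h2 : H ^ σ = H * H ^ (σ - 1) := by
      rw [Real.rpow_sub_one hH.ne']; field_simp
    rw [Real.mul_rpow (by norm_num) hH.le, h2, h1]
    field_simp
  all_goals
    intro τ hτ h
    -- The choice `b = τ` lies strictly between `τ / 2 ^ (σ - 1)`, the parameter of the test space,
    -- and `(2 ^ σ - 1) τ`, the parameter of the growth bound. The slack on both sides makes a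
    -- single `H` enough, also in the Roumieu case, where `H = 1` is taken.
    have h2 : (2 : ℝ) < 2 ^ σ := by
      simpa using Real.rpow_lt_rpow_of_exponent_lt one_lt_two hσ
    have h3 : (1 : ℝ) < 2 ^ (σ - 1) := Real.one_lt_rpow one_lt_two hσ1
    have h4 : τ / 2 ^ (σ - 1) < τ := div_lt_self hτ h3
    have h5 : τ < (2 ^ σ - 1) * τ := by nlinarith
  · obtain ⟨A, hA, H, hH, h⟩ := h
    exact ExtGevrey.hasBoundaryValue_beurling hΓ_open hΓ_cone hΓ_conn hF hσ hγ le_rfl hτ h4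
      (ExtGevrey.hasGrowth_of_assocFun hσ hτ h5 hH hA h)
  · obtain ⟨A, hA, h⟩ := h 1 one_pos
    exact ExtGevrey.hasBoundaryValue_roumieu hΓ_open hΓ_cone hΓ_conn hF hσ hγ le_rfl _ h4
      (ExtGevrey.hasGrowth_of_assocFun hσ hτ h5 one_pos hA h)
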